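/- Let $\mathbf{Diffeo}$ be the category of diffeological spaces and smooth maps. For $m\ge 0$ let $\mathbf\Delta^m=\{x\in\mathbf R^{m+1} : \sum_i x_i=1\}$ be the extended smooth simplex, a map $f:[m]\to[n]$ of simplices acting by $x\mapsto\bigl(j\mapsto\sum_{f(i)=j}x_i\bigr)$. Let $\mathrm{SmSing}:\mathbf{Diffeo}\to\mathbf{sSet}$ be the smooth singular complex functor, $(\mathrm{SmSing}\,X)_n=\mathrm{Hom}(\mathbf\Delta^n,X)$, and let $|{-}|:\mathbf{sSet}\to\mathbf{Diffeo}$ be its left adjoint. Identify $|\Delta^3|$ with $\mathbf R^3$ so that its four faces are $\{v_0+v_1+v_2=1\}$ (the face opposite to vertex $0$) and $\{v_i=0\}$, $i=0,1,2$; then $|\Lambda^3_0|$ is the union of the three planes $v_i=0$, glued along their intersections. Indices $i$ are taken modulo $3$, $e_0,e_1,e_2$ is the standard basis of $\mathbf R^3$, and $C\subset[0,1]$ is the Cantor set. Call *oscillating circle* a smooth $6$-periodic map $S:\mathbf R\to\mathbf R^3$ such that for $i=0,1,2$: - the curve $f(t)=S(2i+t)$, $t\in[0,1]$, sends every point of $C$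 to $e_i$; it sends the open middle thirds removed at stage $k\ge 0$ of the construction of $C$ (these have length $3^{-k-1}$) to $\{v_{i+1}=0,\ v_{i+2}>0\}$ if $k$ is even and to $\{v_{i+2}=0,\ v_{i+1}>0\}$ if $k$ is odd; and the images of different removed open intervals are disjoint; - on $[2i+1,2i+2]$ the map $S$ is a monotone parametrization of the straight line segment from $e_i$ to $e_{i+1}$: $S(2i+1+t)=(1-\varphi(t))e_i+\varphi(t)e_{i+1}$ for $t\in[0,1]$, with $\varphi$ monotone, $\varphi(0)=0$, $\varphi(1)=1$. For an oscillating circle $S$, let $F_S$ be the smallest diffeological subspace of $|\Delta^3|$ (a set of points with a diffeology consisting of plots of $|\Delta^3|$) that contains the plots that factor through $|\Lambda^3_0|$ and the plot $S$. **Theorem.** 1. The category $\mathbf{Diffeo}$ does not admit a model structure transferred along $\mathrm{SmSing}$ from the Kan–Quillen model structure on $\mathbf{sSet}$, i.e., a model structure in which a morphism $f$ is a weak equivalence (respectively a fibration) if and only if $\mathrm{SmSing}\,f$ is a Kan–Quillen weak equivalence (respectively a Kan fibration). 2. Oscillating circles exist. For every oscillating circle $S$, the pushout in $\mathbf{Diffeo}$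 of the smooth horn inclusion $|\Lambda^3_0|\to|\Delta^3|$ along the inclusion $|\Lambda^3_0|\to F_S$ is the inclusion $F_S\to|\Delta^3|$ (with the identity $|\Delta^3|\to|\Delta^3|$ as the other structure map), and $\mathrm{SmSing}$ of this inclusion is not a Kan–Quillen weak equivalence. -/

import Mathlib

open CategoryTheory Opposite Simplicial HomotopicalAlgebra SSet.modelCategoryQuillen
open scoped ContDiff

/-! ### The category of diffeological spaces -/

/-- A (small) diffeological space. -/
structure Diffeo : Type 1 where
  /-- The underlying set. -/
  carrier : Type
  [str : DiffeologicalSpace carrier]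

namespace Diffeo

instance : CoeSort Diffeo Type := ⟨Diffeo.carrier⟩

instance (X : Diffeo) : DiffeologicalSpace X := X.str

/-- Morphisms of diffeological spaces are the smooth maps. -/
@[ext]
structure Hom (X Y : Diffeo) : Type where
  /-- The underlying map. -/
  toFun : X → Y
  smooth : Diffeology.DSmooth toFun

instance : Category Diffeo where
  Hom := Hom
  id X := ⟨id, Diffeology.dSmooth_id⟩
  comp f g := ⟨g.toFun ∘ f.toFun, g.smooth.comp f.smooth⟩

@[ext]
theorem hom_ext {X Y : Diffeo} {f g : X ⟶ Y} (h : ∀ x, f.toFun x = g.toFun x) : f = g :=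
  Hom.ext (funext h)

/-- The diffeology induced by a map `f : A → X`: a map to `A` is a plot iff its composition with
`f` is a plot of `X`. -/
abbrev induced {A X : Type} [DiffeologicalSpace X] (f : A → X) : DiffeologicalSpace A where
  plots n := {p | Diffeology.IsPlot (n := n) (f ∘ p)}
  constant_plots _ := Diffeology.isPlot_const
  plot_reparam hp hf := Diffeology.isPlot_reparam hp hf
  locality hp := DiffeologicalSpace.locality fun x => by
    obtain ⟨u, hu, hx, h⟩ := hp x
    exact ⟨u, hu, hx, fun hfu hf => h hfu hf⟩

/-- A map out of a generated diffeology is smooth if it sends the generating plots to plots. -/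
theorem dSmooth_of_generateFrom {A X : Type} [DiffeologicalSpace X]
    {g : Set ((n : ℕ) × (EuclideanSpace ℝ (Fin n) → A))} {f : A → X}
    (h : ∀ (n : ℕ) (p : EuclideanSpace ℝ (Fin n) → A), ⟨n, p⟩ ∈ g → Diffeology.IsPlot (f ∘ p)) :
    @Diffeology.DSmooth A X (DiffeologicalSpace.generateFrom g) _ f := fun _ _ hp =>
  hp (induced f) fun q hq => h q.1 q.2 hq

end Diffeo

/-! ### Extended smooth simplices and the smooth singular complex -/

/-- The extended smooth simplex `{x ∈ ℝ^[m] | ∑ i, x i = 1}`. -/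
@[ext]
structure ExtSimplex (m : SimplexCategory) : Type where
  /-- The barycentric coordinates. -/
  coord : Fin (m.len + 1) → ℝ
  sum_coord : ∑ i, coord i = 1

namespace ExtSimplex

/-- The plots of the extended simplex are the maps that are smooth as maps to `ℝ^[m]`. -/
noncomputable instance (m : SimplexCategory) : DiffeologicalSpace (ExtSimplex m) :=
  @Diffeo.induced _ (Fin (m.len + 1) → ℝ) (NormedSpace.toDiffeology _) coord

theorem isPlot_iff {m : SimplexCategory} {n : ℕ} {p : EuclideanSpace ℝ (Fin n) → ExtSimplex m} :
    Diffeology.IsPlot p ↔ ContDiff ℝ ∞ fun u => (p u).coord := Iff.rfl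

/-- The map of extended simplices `x ↦ (j ↦ ∑_{i : f i = j} x i)` induced by a map of simplices. -/
noncomputable def map {m n : SimplexCategory} (f : m ⟶ n) (x : ExtSimplex m) : ExtSimplex n where
  coord j := ∑ i with f.toOrderHom i = j, x.coord i
  sum_coord := by rw [Finset.sum_fiberwise]; exact x.sum_coord

theorem map_smooth {m n : SimplexCategory} (f : m ⟶ n) : Diffeology.DSmooth (map f) := by
  intro k p hp
  rw [isPlot_iff] at hp ⊢
  rw [contDiff_pi] at hp ⊢
  intro j
  exact ContDiff.sum (s := {i | f.toOrderHom i = j}) fun i _ => hp i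

theorem map_id {m : SimplexCategory} (x : ExtSimplex m) : map (𝟙 m) x = x := by
  ext j
  simp [map, Finset.sum_filter]

theorem map_comp {l m n : SimplexCategory} (f : l ⟶ m) (g : m ⟶ n) (x : ExtSimplex l) :
    map (f ≫ g) x = map g (map f x) := by
  ext j
  simp only [map]
  rw [← Finset.sum_fiberwise_of_maps_to (s := {i | (f ≫ g).toOrderHom i = j})
    (t := {i | g.toOrderHom i = j}) (g := f.toOrderHom)]
  · refine Finset.sum_congr rfl fun i hi => Finset.sum_congr ?_ fun _ _ => rfl
    ext k
    simp only [Finset.mem_filter, Finset.mem_univ, true_and] at hi ⊢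
    constructor
    · exact fun h => h.2
    · intro h
      refine ⟨?_, h⟩
      simp [h, hi]
  · intro i hi
    simpa using hi

end ExtSimplex

/-- The cosimplicial diffeological space of extended smooth simplices. -/
noncomputable def extSimplexFunctor : SimplexCategory ⥤ Diffeo where
  obj m := ⟨ExtSimplex m⟩
  map f := ⟨ExtSimplex.map f, ExtSimplex.map_smooth f⟩
  map_id _ := Diffeo.hom_ext fun x => ExtSimplex.map_id x
  map_comp f g := Diffeo.hom_ext fun x => ExtSimplex.map_comp f g x

/-- The smooth singular complex functor: the `n`-simplices of `SmSing X` are the smooth maps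
`Δⁿ → X` from the extended smooth simplex, and the simplicial structure is given by
precomposition. -/
noncomputable def SmSing : Diffeo ⥤ SSet.{0} :=
  yoneda ⋙ (Functor.whiskeringLeft _ _ _).obj extSimplexFunctor.op

/-! ### The smooth realization, left adjoint to the smooth singular complex -/

namespace SmReal

/-- Pairs of a simplex of `X` and a point of the corresponding extended smooth simplex. -/
abbrev Pre (X : SSet.{0}) : Type :=
  (n : SimplexCategory) × (X.obj (op n) × ExtSimplex n)

/-- The identifications `(f^* x, y) ∼ (x, f_* y)` in the realization. -/
def Rel (X : SSet.{0}) (a b : Pre X) : Prop :=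
  ∃ f : a.1 ⟶ b.1, a.2.1 = X.map f.op b.2.1 ∧ b.2.2 = ExtSimplex.map f a.2.2

/-- The underlying set of the realization. -/
def Pt (X : SSet.{0}) : Type := Quot (Rel X)

/-- The point of the realization given by a simplex `x` of `X` and a point of `Δⁿ`. -/
def pt {X : SSet.{0}} {n : SimplexCategory} (x : X.obj (op n)) (y : ExtSimplex n) : Pt X :=
  Quot.mk _ ⟨n, x, y⟩

/-- The diffeology on the realization is generated by the smooth maps to the simplices, i.e. it is
the quotient diffeology. -/
noncomputable instance (X : SSet.{0}) : DiffeologicalSpace (Pt X) :=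
  DiffeologicalSpace.generateFrom
    {q | ∃ (n : SimplexCategory) (x : X.obj (op n))
      (r : EuclideanSpace ℝ (Fin q.1) → ExtSimplex n),
      Diffeology.IsPlot r ∧ q.2 = fun u => pt x (r u)}

theorem pt_smooth {X : SSet.{0}} {n : SimplexCategory} (x : X.obj (op n)) :
    Diffeology.DSmooth (pt x) := fun _ r hr =>
  DiffeologicalSpace.isPlot_generatedFrom_of_mem ⟨n, x, r, hr, rfl⟩

theorem pt_map {X : SSet.{0}} {m n : SimplexCategory} (f : m ⟶ n) (x : X.obj (op n))
    (y : ExtSimplex m) : pt (X.map f.op x) y = pt x (ExtSimplex.map f y) :=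
  Quot.sound ⟨f, rfl, rfl⟩

/-- The inclusion of the extended simplex corresponding to a simplex of `X`. -/
noncomputable def ptHom {X : SSet.{0}} {n : SimplexCategory} (x : X.obj (op n)) :
    extSimplexFunctor.obj n ⟶ (⟨Pt X⟩ : Diffeo) :=
  Diffeo.Hom.mk (X := extSimplexFunctor.obj n) (Y := ⟨Pt X⟩) (pt x) (pt_smooth x)

/-- The smooth map given by a simplex of the smooth singular complex. -/
def simplexHom {Y : Diffeo} {n : SimplexCategory} (x : (SmSing.obj Y).obj (op n)) :
    extSimplexFunctor.obj n ⟶ Y := x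

/-- A compatible family of smooth maps out of the simplices glues to a smooth map out of the
realization. -/
noncomputable def desc {X : SSet.{0}} {Y : Diffeo} (φ : X ⟶ SmSing.obj Y) :
    (⟨Pt X⟩ : Diffeo) ⟶ Y where
  toFun := Quot.lift (fun a => (simplexHom (φ.app (op a.1) a.2.1)).toFun a.2.2) (by
    rintro ⟨m, x, y⟩ ⟨n, x', y'⟩ ⟨f, h, h'⟩
    dsimp only at f h h'
    subst h'
    rw [h]
    have := ConcreteCategory.congr_hom (φ.naturality f.op) x'
    exact congrArg (fun g => (simplexHom g).toFun y) this)
  smooth := Diffeo.dSmooth_of_generateFrom (by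
    rintro k p ⟨n, x, r, hr, h⟩
    change p = _ at h
    rw [h]
    exact (simplexHom (φ.app (op n) x)).smooth _ _ hr)

/-- The natural bijection between smooth maps `|X| → Y` and simplicial maps `X → SmSing Y`. -/
noncomputable def homEquiv (X : SSet.{0}) (Y : Diffeo) :
    ((⟨Pt X⟩ : Diffeo) ⟶ Y) ≃ (X ⟶ SmSing.obj Y) where
  toFun f :=
    { app n := TypeCat.ofHom fun x => ptHom (n := n.unop) x ≫ f
      naturality := by
        intro m n g
        ext x
        exact Diffeo.hom_ext fun y => congrArg f.toFun (pt_map g.unop x y) }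
  invFun := desc
  left_inv f := by
    apply Diffeo.hom_ext
    rintro ⟨a⟩
    rfl
  right_inv φ := by
    ext n x
    rfl

/-- The map of realizations induced by a simplicial map `φ` sends the point `y` of the simplex `x`
to the point `y` of the simplex `φ x`. -/
noncomputable def map {X X' : SSet.{0}} (φ : X ⟶ X') : (⟨Pt X⟩ : Diffeo) ⟶ ⟨Pt X'⟩ where
  toFun := Quot.lift (fun a => pt (φ.app (op a.1) a.2.1) a.2.2) (by
    rintro ⟨m, x, y⟩ ⟨n, x', y'⟩ ⟨f, h, h'⟩
    dsimp only at f h h'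
    subst h'
    rw [h]
    have := ConcreteCategory.congr_hom (φ.naturality f.op) x'
    exact (congrArg (fun z => pt z y) this).trans (pt_map f _ y))
  smooth := Diffeo.dSmooth_of_generateFrom (by
    rintro k p ⟨n, x, r, hr, h⟩
    change p = _ at h
    rw [h]
    exact pt_smooth (φ.app (op n) x) _ _ hr)

end SmReal

/-- The smooth realization functor `|-| : sSet ⥤ Diffeo`; explicitly `|X|` is the colimit of the
extended smooth simplices over the category of simplices of `X`. -/
noncomputable def smReal : SSet.{0} ⥤ Diffeo where
  obj X := ⟨SmReal.Pt X⟩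
  map φ := SmReal.map φ
  map_id X := by
    apply Diffeo.hom_ext
    rintro ⟨a⟩
    rfl
  map_comp f g := by
    apply Diffeo.hom_ext
    rintro ⟨a⟩
    rfl

/-- The smooth realization is left adjoint to the smooth singular complex. -/
noncomputable def smAdj : smReal ⊣ SmSing :=
  Adjunction.mkOfHomEquiv
    { homEquiv := SmReal.homEquiv
      homEquiv_naturality_left_symm := by
        intro X' X Y f g
        apply Diffeo.hom_ext
        rintro ⟨a⟩
        rfl
      homEquiv_naturality_right := by
        intros
        rfl }

instance : SmSing.IsRightAdjoint := smAdj.isRightAdjoint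

/-! ### The Kan–Quillen classes of simplicial maps, and transferred model structures -/

/-- Two simplicial maps are homotopic if there is a simplicial homotopy `X × Δ[1] ⟶ K` from the
first one to the second one. (For a Kan complex `K` this is an equivalence relation.) -/
def SimplicialHomotopic {X K : SSet.{0}} (f g : X ⟶ K) : Prop := Nonempty (SSet.Homotopy f g)

/-- The weak equivalences of the Kan–Quillen model structure on simplicial sets: the maps
`f : X ⟶ Y` such that precomposition with `f` is a bijection `[Y, K] → [X, K]` of homotopy classes
of maps, for every Kan complex `K`. -/
def IsWeakEquiv {X Y : SSet.{0}} (f : X ⟶ Y) : Prop :=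
  ∀ (K : SSet.{0}) [SSet.KanComplex K],
    (∀ g : X ⟶ K, ∃ h : Y ⟶ K, SimplicialHomotopic (f ≫ h) g) ∧
    (∀ h h' : Y ⟶ K, SimplicialHomotopic (f ≫ h) (f ≫ h') → SimplicialHomotopic h h')

/-- The Kan–Quillen weak equivalences. The Kan–Quillen fibrations (the Kan fibrations) are provided
by Mathlib. -/
instance : CategoryWithWeakEquivalences SSet.{0} where
  weakEquivalences _ _ f := IsWeakEquiv f

/-- A model structure on `D` is transferred along `R : D ⥤ C` if its weak equivalences and its
fibrations are created by `R`. -/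
def IsTransferredAlong {C D : Type 1} [Category.{0} C] [Category.{0} D]
    [CategoryWithWeakEquivalences C] [CategoryWithFibrations C] (R : D ⥤ C)
    [ModelCategory D] : Prop :=
  weakEquivalences D = (weakEquivalences C).inverseImage R ∧
    fibrations D = (fibrations C).inverseImage R

/-! ### Diffeological subspaces generated by plots -/

namespace Diffeo

/-- The smallest diffeological subspace of `Y` containing a given set `P` of plots of `Y`, i.e. the
intersection of all diffeological subspaces (sets of points of `Y` with a diffeology consisting of
plots of `Y`) containing these plots: its points are the values of the plots in `P`, and its
diffeology is the smallest one containing the plots in `P`. -/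
def generated (Y : Diffeo) (P : Set ((n : ℕ) × (EuclideanSpace ℝ (Fin n) → Y))) : Diffeo where
  carrier := {y : Y // ∃ q ∈ P, y ∈ Set.range q.2}
  str := DiffeologicalSpace.generateFrom {q | ⟨q.1, fun u => (q.2 u).1⟩ ∈ P}

/-- The inclusion of the diffeological subspace generated by a set of plots. -/
def generatedIncl (Y : Diffeo) (P : Set ((n : ℕ) × (EuclideanSpace ℝ (Fin n) → Y)))
    (hP : ∀ q ∈ P, Diffeology.IsPlot q.2) : generated Y P ⟶ Y where
  toFun y := y.1
  smooth := dSmooth_of_generateFrom fun _ _ hq => hP _ hq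

/-- A smooth map to `Y` sending all plots to plots in `P` factors through the diffeological
subspace generated by `P`. -/
def generatedLift {Y Z : Diffeo} (P : Set ((n : ℕ) × (EuclideanSpace ℝ (Fin n) → Y)))
    (f : Z ⟶ Y)
    (hf : ∀ (n : ℕ) (p : EuclideanSpace ℝ (Fin n) → Z), Diffeology.IsPlot p → ⟨n, f.toFun ∘ p⟩ ∈ P) :
    Z ⟶ generated Y P where
  toFun z := ⟨f.toFun z, _, hf 0 (fun _ => z) Diffeology.isPlot_const, 0, rfl⟩
  smooth n p hp := DiffeologicalSpace.isPlot_generatedFrom_of_mem (hf n p hp)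

end Diffeo

/-! ### The circle oscillating along the Cantor set -/

/-- The `i`-th standard basis vector of `ℝ³`. -/
def cornerPt (i : Fin 3) : Fin 3 → ℝ := Pi.single i 1

/-- `f : ℝ → ℝ³`, restricted to `[0, 1]`, oscillates along the Cantor set between the two coordinate
planes that meet in the `i`-th coordinate axis: it sends the Cantor set to the point `e_i`, and it
sends the open middle thirds removed at stage `k` of the construction of the Cantor set to the open
half-plane `{v_{i+1} = 0, v_{i+2} > 0}` if `k` is even and `{v_{i+2} = 0, v_{i+1} > 0}` if `k` is
odd, with the images of different middle thirds being disjoint (indices are modulo 3). -/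
structure OscillatesAt (i : Fin 3) (f : ℝ → Fin 3 → ℝ) : Prop where
  map_cantor : ∀ t ∈ cantorSet, f t = cornerPt i
  map_even : ∀ k : ℕ, Even k → ∀ t ∈ preCantorSet k \ preCantorSet (k + 1),
    f t (i + 1) = 0 ∧ 0 < f t (i + 2)
  map_odd : ∀ k : ℕ, Odd k → ∀ t ∈ preCantorSet k \ preCantorSet (k + 1),
    f t (i + 2) = 0 ∧ 0 < f t (i + 1)
  disjoint : ∀ t ∈ Set.Icc 0 1 \ cantorSet, ∀ t' ∈ Set.Icc 0 1 \ cantorSet,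
    f t = f t' → Disjoint (Set.uIcc t t') cantorSet

/-- A smooth circle `ℝ/6ℤ → ℝ³` made of three oscillating curves at the three points `e_0`, `e_1`,
`e_2`, joined by monotone parametrizations of straight line segments. (Vanishing of all derivatives
at the ends of the segments and at the points of the Cantor sets follows from smoothness.) -/
structure OscillatingCircle where
  /-- The underlying periodic map. -/
  toFun : ℝ → Fin 3 → ℝ
  smooth : ContDiff ℝ ∞ toFun
  periodic : Function.Periodic toFun 6
  oscillates : ∀ i : Fin 3, OscillatesAt i fun t => toFun (2 * (i : ℕ) + t)
  segment : ∀ i : Fin 3, ∃ φ : ℝ → ℝ, MonotoneOn φ (Set.Icc 0 1) ∧ φ 0 = 0 ∧ φ 1 = 1 ∧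
    ∀ t ∈ Set.Icc (0 : ℝ) 1, toFun (2 * (i : ℕ) + 1 + t) =
      (1 - φ t) • cornerPt i + φ t • cornerPt (i + 1)

/-! ### The subspace `F` of `|Δ³|` -/

/-- The smooth horn inclusion `|Λ³₀| ⟶ |Δ³|`. -/
noncomputable def smoothHorn : smReal.obj (Λ[3, 0] : SSet.{0}) ⟶ smReal.obj Δ[3] :=
  smReal.map Λ[3, 0].ι

/-- The parametrization `ℝ³ → |Δ³|` in which the faces of `|Δ³|` are `x + y + z = 1`, `x = 0`,
`y = 0` and `z = 0`: the point `v` has barycentric coordinates `(1 - ∑ v_i, v_0, v_1, v_2)`. -/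
noncomputable def chart (v : Fin 3 → ℝ) : smReal.obj (Δ[3] : SSet.{0}) :=
  SmReal.pt (n := ⦋3⦌) (SSet.stdSimplex.objEquiv.symm (𝟙 ⦋3⦌))
    { coord := Fin.cons (1 - ∑ i, v i) v
      sum_coord := by simp [Fin.sum_univ_succ] }

theorem chart_isPlot {n : ℕ} {g : EuclideanSpace ℝ (Fin n) → Fin 3 → ℝ} (hg : ContDiff ℝ ∞ g) :
    Diffeology.IsPlot fun u => chart (g u) := by
  refine SmReal.pt_smooth _ n _ (ExtSimplex.isPlot_iff.2 ?_)
  have hg' := contDiff_pi.1 hg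
  refine contDiff_pi.2 fun j => ?_
  refine Fin.cases ?_ (fun i => ?_) j
  · exact contDiff_const.sub (ContDiff.sum fun i _ => hg' i)
  · exact hg' i

namespace OscillatingCircle

/-- The plots of `|Δ³|` that factor through `|Λ³₀|`, together with the plot `ℝ → S¹ → |Δ³|` given by
an oscillating circle. -/
noncomputable def plots (S : OscillatingCircle) :
    Set ((n : ℕ) × (EuclideanSpace ℝ (Fin n) → smReal.obj (Δ[3] : SSet.{0}))) :=
  {q | ∃ p : EuclideanSpace ℝ (Fin q.1) → smReal.obj (Λ[3, 0] : SSet.{0}),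
      Diffeology.IsPlot p ∧ q.2 = smoothHorn.toFun ∘ p} ∪
    {⟨1, fun u => chart (S.toFun (u 0))⟩}

/-- The diffeological subspace `F` of `|Δ³|` generated by `|Λ³₀|` and an oscillating circle. -/
noncomputable def F (S : OscillatingCircle) : Diffeo :=
  Diffeo.generated (smReal.obj Δ[3]) S.plots

/-- The inclusion `F ⟶ |Δ³|`. -/
noncomputable def FIncl (S : OscillatingCircle) : S.F ⟶ smReal.obj Δ[3] :=
  Diffeo.generatedIncl _ S.plots (by
    rintro q (⟨p, hp, h⟩ | h)
    · rw [h]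
      exact smoothHorn.smooth _ p hp
    · subst h
      exact chart_isPlot (S.smooth.comp (contDiff_euclidean.1 contDiff_id 0)))

/-- The inclusion `|Λ³₀| ⟶ F`. -/
noncomputable def hornToF (S : OscillatingCircle) : smReal.obj (Λ[3, 0] : SSet.{0}) ⟶ S.F :=
  Diffeo.generatedLift S.plots smoothHorn fun _ p hp => Or.inl ⟨p, hp, rfl⟩

end OscillatingCircle

/-! By adjunction, a transferred structure makes the smooth horn inclusion lift against every
fibration, so it and its pushouts are trivial cofibrations (`trivialCofibrations_smoothHorn`). The
circle lies in the union of the coordinate planes, so `hornToF` is onto, and this already forces the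
pushout to be |Δ³| (`isPushout`). What remains is that a circle exists and that `FIncl` is not a
weak equivalence.

The obstruction is a class of degree one with real coefficients, a map to the Kan complex
`cocycleComplex`. Homotopic maps to it agree on loops (`val_eq_of_homotopy`), and every map from
SmSing |Δ³| vanishes on loops because |Δ³| is ℝ³ (`val_loop_eq_zero`). But `cocycleMap` on SmSing F
takes the value 1 on the circle (`val_loop`), so up to homotopy it does not extend to SmSing |Δ³|.

This cocycle measures the progress of a path through the Cantor set. A plot of F locally stays in a
coordinate plane or factors through the circle (`exists_localModel_FIncl`); its primitive is
constant in the first case and the Cantor function of the lift to ℝ in the second. Ambiguity can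
only matter where the Cantor function of a lift varies. There the lift passes through gaps of both
parities, so the plot lies in no plane (`not_eventually_eq_zero`), and since different gaps have
disjoint images, all lifts agree at such points (`eq_of_not_eventually`). Hence primitives are
unique up to constants on connected sets (`IsPrimitive.sub_eq`), and they glue over compact
simplices (`exists_isPrimitive`).

Circles exist because a smooth function vanishing off the gaps stays smooth when multiplied by a
bounded weight that is locally constant on the gaps (`IsGapWeight.contDiff_mul`); such weights
select the plane and separate the gaps. -/

open Filter Topology

/-! ### Gaps of the Cantor set -/

/-- The union of the open middle thirds removed at stage `k` of the construction of the Cantor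
set. -/
def cantorGap (k : ℕ) : Set ℝ := preCantorSet k \ preCantorSet (k + 1)

theorem div_three_mem_cantorSet {c : ℝ} (hc : c ∈ cantorSet) : c / 3 ∈ cantorSet := by
  rw [cantorSet_eq_union_halves]
  exact Or.inl ⟨c, hc, rfl⟩

theorem two_add_div_three_mem_cantorSet {c : ℝ} (hc : c ∈ cantorSet) :
    (2 + c) / 3 ∈ cantorSet := by
  rw [cantorSet_eq_union_halves]
  exact Or.inr ⟨c, hc, rfl⟩

theorem one_mem_cantorSet : (1 : ℝ) ∈ cantorSet := by
  refine Set.mem_iInter.2 fun n => ?_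
  induction n with
  | zero => simp
  | succ n ih => exact Or.inr ⟨1, ih, by norm_num⟩

theorem cantorGap_zero : cantorGap 0 = Set.Ioo (1 / 3) (2 / 3) := by
  ext t
  simp only [cantorGap, preCantorSet_succ, preCantorSet_zero, Set.mem_sdiff, Set.mem_union,
    Set.mem_image, Set.mem_Icc, Set.mem_Ioo, not_or, not_exists, not_and]
  constructor
  · rintro ⟨⟨h0, h1⟩, h2, h3⟩
    constructor
    · by_contra! h
      exact h2 (3 * t) ⟨by linarith, by linarith⟩ (by ring)
    · by_contra! h
      exact h3 (3 * t - 2) ⟨by linarith, by linarith⟩ (by ring)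
  · rintro ⟨h0, h1⟩
    refine ⟨⟨by linarith, by linarith⟩, ?_, ?_⟩
    · rintro x hx rfl
      linarith [hx.2]
    · rintro x hx rfl
      linarith [hx.1]

/-- The two scaled copies lie in the disjoint thirds [0, 1/3] and [2/3, 1], so a point removed from
one copy is not put back by the other. -/
theorem cantorGap_succ (k : ℕ) :
    cantorGap (k + 1) = (fun x => x / 3) '' cantorGap k ∪ (fun x => (2 + x) / 3) '' cantorGap k := by
  have hI : ∀ n, ∀ x ∈ preCantorSet n, x ∈ Set.Icc (0 : ℝ) 1 :=
    fun n x hx => preCantorSet_subset_unitInterval hx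
  ext t
  constructor
  · rintro ⟨⟨x, hx, rfl⟩ | ⟨x, hx, rfl⟩, h⟩
    · exact Or.inl ⟨x, ⟨hx, fun h' => h (Or.inl ⟨x, h', rfl⟩)⟩, rfl⟩
    · exact Or.inr ⟨x, ⟨hx, fun h' => h (Or.inr ⟨x, h', rfl⟩)⟩, rfl⟩
  · rintro (⟨x, ⟨hx, hx'⟩, rfl⟩ | ⟨x, ⟨hx, hx'⟩, rfl⟩)
    · refine ⟨Or.inl ⟨x, hx, rfl⟩, ?_⟩
      rintro (⟨y, hy, h⟩ | ⟨y, hy, h⟩)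
      · have : y = x := by dsimp at h; linarith
        exact hx' (this ▸ hy)
      · have h1 := hI _ _ hx
        have h2 := hI _ _ hy
        dsimp at h
        linarith [h1.2, h2.1]
    · refine ⟨Or.inr ⟨x, hx, rfl⟩, ?_⟩
      rintro (⟨y, hy, h⟩ | ⟨y, hy, h⟩)
      · have h1 := hI _ _ hx
        have h2 := hI _ _ hy
        dsimp at h
        linarith [h1.1, h2.2]
      · have : y = x := by dsimp at h; linarith
        exact hx' (this ▸ hy)

theorem image_div_three (s : Set ℝ) : (fun x => x / 3) '' s = (fun x => 3 * x) ⁻¹' s := by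
  ext t
  constructor
  · rintro ⟨x, hx, rfl⟩
    simpa [mul_div_cancel₀] using hx
  · intro h
    exact ⟨3 * t, h, by simp⟩

theorem image_two_add_div_three (s : Set ℝ) :
    (fun x => (2 + x) / 3) '' s = (fun x => 3 * x - 2) ⁻¹' s := by
  ext t
  constructor
  · rintro ⟨x, hx, rfl⟩
    have : 3 * ((2 + x) / 3) - 2 = x := by ring
    simpa only [Set.mem_preimage, this] using hx
  · intro h
    exact ⟨3 * t - 2, h, by ring⟩

theorem isOpen_cantorGap (k : ℕ) : IsOpen (cantorGap k) := by
  induction k with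
  | zero => rw [cantorGap_zero]; exact isOpen_Ioo
  | succ k ih =>
    rw [cantorGap_succ, image_div_three, image_two_add_div_three]
    exact (ih.preimage (by fun_prop)).union (ih.preimage (by fun_prop))

theorem exists_mem_cantorGap {t : ℝ} (h0 : 0 ≤ t) (h1 : t ≤ 1) (ht : t ∉ cantorSet) :
    ∃ k, t ∈ cantorGap k := by
  by_contra! h
  refine ht (Set.mem_iInter.2 fun n => ?_)
  induction n with
  | zero => exact ⟨h0, h1⟩
  | succ n ih => exact not_not.1 fun h' => h n ⟨ih, h'⟩

theorem cantorGap_subset_Icc {k : ℕ} : cantorGap k ⊆ Set.Icc 0 1 :=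
  Set.sdiff_subset.trans preCantorSet_subset_unitInterval

theorem notMem_cantorSet_of_mem_cantorGap {k : ℕ} {t : ℝ} (ht : t ∈ cantorGap k) :
    t ∉ cantorSet := fun h => ht.2 (Set.mem_iInter.1 h _)

theorem cantorGap_unique {k l : ℕ} {t : ℝ} (hk : t ∈ cantorGap k) (hl : t ∈ cantorGap l) :
    k = l := by
  rcases lt_trichotomy k l with h | h | h
  · exact absurd (preCantorSet_antitone h hl.1) hk.2
  · exact h
  · exact absurd (preCantorSet_antitone h hk.1) hl.2

/-- Every neighbourhood of a point of the Cantor set contains gaps of every late enough stage. -/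
theorem exists_cantorGap_near {c : ℝ} (hc : c ∈ cantorSet) (j : ℕ) :
    ∃ c₁ ∈ cantorSet, ∃ c₂ ∈ cantorSet, ∃ t ∈ cantorGap j,
      c₁ < t ∧ t < c₂ ∧ c - (1 / 3) ^ j ≤ c₁ ∧ c₂ ≤ c + (1 / 3) ^ j := by
  induction j generalizing c with
  | zero =>
    have h := cantorSet_subset_unitInterval hc
    refine ⟨0, zero_mem_cantorSet, 1, one_mem_cantorSet, 1 / 2, ?_, ?_⟩
    · rw [cantorGap_zero]; norm_num
    · have := h.1
      have := h.2
      norm_num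
      constructor <;> linarith
  | succ j ih =>
    rw [cantorSet_eq_union_halves] at hc
    have hp : ((1 : ℝ) / 3) ^ (j + 1) = (1 / 3) ^ j / 3 := by ring
    rw [hp, cantorGap_succ]
    rcases hc with ⟨d, hd, rfl⟩ | ⟨d, hd, rfl⟩ <;> obtain ⟨c₁, h₁, c₂, h₂, t, ht, h⟩ := ih hd
    · refine ⟨c₁ / 3, div_three_mem_cantorSet h₁, c₂ / 3, div_three_mem_cantorSet h₂, t / 3,
        Or.inl ⟨t, ht, rfl⟩, ?_⟩
      dsimp
      refine ⟨?_, ?_, ?_, ?_⟩ <;> linarith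
    · refine ⟨_, two_add_div_three_mem_cantorSet h₁, _, two_add_div_three_mem_cantorSet h₂, _,
        Or.inr ⟨t, ht, rfl⟩, ?_⟩
      dsimp
      refine ⟨?_, ?_, ?_, ?_⟩ <;> linarith

/-- Every neighbourhood of a point of the Cantor set contains gaps of either parity. -/
theorem exists_parity_cantorGap_near {c a b : ℝ} (hc : c ∈ cantorSet) (ha : a < c) (hb : c < b)
    (r : ℕ) :
    ∃ c₁ ∈ cantorSet, ∃ c₂ ∈ cantorSet, ∃ k : ℕ, ∃ t ∈ cantorGap (2 * k + r),
      a < c₁ ∧ c₁ < t ∧ t < c₂ ∧ c₂ < b := by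
  obtain ⟨n, hn⟩ := exists_pow_lt_of_lt_one (lt_min (sub_pos.2 ha) (sub_pos.2 hb))
    (by norm_num : (1 / 3 : ℝ) < 1)
  obtain ⟨c₁, h₁, c₂, h₂, t, ht, h, h', h'', h'''⟩ := exists_cantorGap_near hc (2 * n + r)
  have hle : (1 / 3 : ℝ) ^ (2 * n + r) ≤ (1 / 3) ^ n :=
    pow_le_pow_of_le_one (by norm_num) (by norm_num) (by omega)
  rw [lt_min_iff] at hn
  exact ⟨c₁, h₁, c₂, h₂, n, t, ht, by linarith, h, h', by linarith⟩

/-! ### The Cantor function -/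

/-- Approximations of the Cantor function. -/
noncomputable def cantorApprox (n : ℕ) (t : ℝ) : ℝ :=
  match n with
  | 0 => max 0 (min 1 t)
  | n + 1 => (cantorApprox n (3 * t) + cantorApprox n (3 * t - 2)) / 2

theorem continuous_cantorApprox (n : ℕ) : Continuous (cantorApprox n) := by
  induction n with
  | zero => exact continuous_const.max (continuous_const.min continuous_id)
  | succ n ih =>
    exact ((ih.comp (continuous_const.mul continuous_id)).add
      (ih.comp ((continuous_const.mul continuous_id).sub continuous_const))).div_const 2

theorem cantorApprox_of_nonpos (n : ℕ) {t : ℝ} (ht : t ≤ 0) : cantorApprox n t = 0 := by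
  induction n generalizing t with
  | zero => simp [cantorApprox, ht]
  | succ n ih => simp [cantorApprox, ih (t := 3 * t) (by linarith),
      ih (t := 3 * t - 2) (by linarith)]

theorem cantorApprox_of_one_le (n : ℕ) {t : ℝ} (ht : 1 ≤ t) : cantorApprox n t = 1 := by
  induction n generalizing t with
  | zero => simp [cantorApprox, ht]
  | succ n ih => simp [cantorApprox, ih (t := 3 * t) (by linarith),
      ih (t := 3 * t - 2) (by linarith)]

/-- The recursion halves differences: for `t ≤ 1/2` the second summand is 0 at every stage, for `t ≥
1/2` the first is 1 at every stage, so only one of the two contributes. -/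
theorem abs_cantorApprox_sub_le (n : ℕ) (t : ℝ) :
    |cantorApprox (n + 1) t - cantorApprox n t| ≤ (1 / 2) ^ n := by
  induction n generalizing t with
  | zero =>
    simp only [cantorApprox, pow_zero]
    have h : ∀ s : ℝ, 0 ≤ max 0 (min 1 s) ∧ max 0 (min 1 s) ≤ 1 := fun s =>
      ⟨le_max_left _ _, max_le zero_le_one (min_le_left _ _)⟩
    have h1 := h t
    have h2 := h (3 * t)
    have h3 := h (3 * t - 2)
    rw [abs_le]
    constructor <;> linarith [h1.1, h1.2, h2.1, h2.2, h3.1, h3.2]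
  | succ n ih =>
    have e : cantorApprox (n + 2) t - cantorApprox (n + 1) t =
        ((cantorApprox (n + 1) (3 * t) - cantorApprox n (3 * t)) +
        (cantorApprox (n + 1) (3 * t - 2) - cantorApprox n (3 * t - 2))) / 2 := by
      simp only [cantorApprox.eq_2]
      ring
    have hp : ((1 : ℝ) / 2) ^ (n + 1) = (1 / 2) ^ n / 2 := by ring
    rw [e, hp, abs_div, abs_two]
    refine div_le_div_of_nonneg_right ?_ zero_le_two
    rcases le_total t (1 / 2) with h | h
    · rw [cantorApprox_of_nonpos (n + 1) (t := 3 * t - 2) (by linarith),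
        cantorApprox_of_nonpos n (t := 3 * t - 2) (by linarith), sub_zero, add_zero]
      exact ih _
    · rw [cantorApprox_of_one_le (n + 1) (t := 3 * t) (by linarith),
        cantorApprox_of_one_le n (t := 3 * t) (by linarith), sub_self, zero_add]
      exact ih _

/-- The Cantor function, extended by constants to the real line. -/
noncomputable def cantorFun (t : ℝ) : ℝ :=
  cantorApprox 0 t + ∑' n, (cantorApprox (n + 1) t - cantorApprox n t)

theorem continuous_cantorFun : Continuous cantorFun :=
  (continuous_cantorApprox 0).add
    (continuous_tsum (fun n => (continuous_cantorApprox (n + 1)).sub (continuous_cantorApprox n))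
      summable_geometric_two abs_cantorApprox_sub_le)

theorem tendsto_cantorApprox (t : ℝ) :
    Tendsto (fun n => cantorApprox n t) atTop (𝓝 (cantorFun t)) := by
  have hs : Summable fun n => cantorApprox (n + 1) t - cantorApprox n t :=
    Summable.of_norm_bounded summable_geometric_two fun n => abs_cantorApprox_sub_le n t
  have h := hs.hasSum.tendsto_sum_nat.const_add (cantorApprox 0 t)
  refine h.congr fun n => ?_
  rw [Finset.sum_range_sub (fun n => cantorApprox n t)]
  ring

theorem cantorFun_of_nonpos {t : ℝ} (ht : t ≤ 0) : cantorFun t = 0 :=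
  tendsto_nhds_unique (tendsto_cantorApprox t)
    (by simp only [cantorApprox_of_nonpos _ ht]; exact tendsto_const_nhds)

theorem cantorFun_of_one_le {t : ℝ} (ht : 1 ≤ t) : cantorFun t = 1 :=
  tendsto_nhds_unique (tendsto_cantorApprox t)
    (by simp only [cantorApprox_of_one_le _ ht]; exact tendsto_const_nhds)

theorem cantorFun_eq (t : ℝ) : cantorFun t = (cantorFun (3 * t) + cantorFun (3 * t - 2)) / 2 :=
  tendsto_nhds_unique ((tendsto_add_atTop_iff_nat 1).2 (tendsto_cantorApprox t))
    (((tendsto_cantorApprox (3 * t)).add (tendsto_cantorApprox (3 * t - 2))).div_const 2)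

/-- Induction on the stage through the functional equation `cantorFun_eq`: in each outer third one
summand is constant and the other is a rescaling to a gap of the previous stage. -/
theorem cantorFun_eventually_eq_of_mem_cantorGap {k : ℕ} {t : ℝ} (ht : t ∈ cantorGap k) :
    ∀ᶠ s in 𝓝 t, cantorFun s = cantorFun t := by
  induction k generalizing t with
  | zero =>
    have h : ∀ s ∈ cantorGap 0, cantorFun s = 1 / 2 := by
      intro s hs
      rw [cantorGap_zero] at hs
      rw [cantorFun_eq, cantorFun_of_one_le (by linarith [hs.1]),
        cantorFun_of_nonpos (by linarith [hs.2])]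
      norm_num
    filter_upwards [(isOpen_cantorGap 0).mem_nhds ht] with s hs
    rw [h s hs, h t ht]
  | succ k ih =>
    rw [cantorGap_succ, image_div_three, image_two_add_div_three] at ht
    rcases ht with ht | ht <;> have hI := cantorGap_subset_Icc ht
    · have h1 : ∀ᶠ s in 𝓝 t, s < 1 / 2 :=
        eventually_lt_nhds (by linarith [hI.2])
      have h2 := (Continuous.tendsto (by fun_prop : Continuous fun s : ℝ => 3 * s) t).eventually
        (ih ht)
      filter_upwards [h1, h2] with s hs hs'
      rw [cantorFun_eq s, cantorFun_eq t, hs', cantorFun_of_nonpos (t := 3 * s - 2) (by linarith),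
        cantorFun_of_nonpos (t := 3 * t - 2) (by linarith [hI.2])]
    · have h1 : ∀ᶠ s in 𝓝 t, 1 / 2 < s :=
        eventually_gt_nhds (by linarith [hI.1])
      have h2 := (Continuous.tendsto (by fun_prop : Continuous fun s : ℝ => 3 * s - 2) t).eventually
        (ih ht)
      filter_upwards [h1, h2] with s hs hs'
      rw [cantorFun_eq s, cantorFun_eq t, hs', cantorFun_of_one_le (t := 3 * s) (by linarith),
        cantorFun_of_one_le (t := 3 * t) (by linarith [hI.1])]

theorem cantorFun_eventually_eq {t : ℝ} (ht : t ∉ cantorSet) :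
    ∀ᶠ s in 𝓝 t, cantorFun s = cantorFun t := by
  rcases lt_or_ge t 0 with h0 | h0
  · filter_upwards [eventually_lt_nhds h0] with s hs
    rw [cantorFun_of_nonpos hs.le, cantorFun_of_nonpos h0.le]
  rcases lt_or_ge 1 t with h1 | h1
  · filter_upwards [eventually_gt_nhds h1] with s hs
    rw [cantorFun_of_one_le hs.le, cantorFun_of_one_le h1.le]
  · obtain ⟨k, hk⟩ := exists_mem_cantorGap h0 h1 ht
    exact cantorFun_eventually_eq_of_mem_cantorGap hk

/-- A function on a preconnected set that is locally constant is constant. -/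
theorem IsPreconnected.eq_of_eventually_eq {X : Type*} [TopologicalSpace X] {s : Set X}
    (hs : IsPreconnected s) {f : X → ℝ}
    (h : ∀ x ∈ s, ∀ᶠ y in 𝓝[s] x, f y = f x) {x y : X} (hx : x ∈ s) (hy : y ∈ s) : f x = f y := by
  have := isPreconnected_iff_preconnectedSpace.1 hs
  have hl : IsLocallyConstant (s.domRestrict f) := by
    rw [IsLocallyConstant.iff_eventually_eq]
    intro z
    have := h z z.2
    rw [← map_nhds_subtype_val] at this
    exact this
  exact hl.apply_eq_of_preconnectedSpace ⟨x, hx⟩ ⟨y, hy⟩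

/-- Between two points at which the Cantor function differs there are gaps of either parity. -/
theorem exists_cantorGap_of_cantorFun_ne {a b : ℝ} (hab : a < b) (h : cantorFun a ≠ cantorFun b)
    (r : ℕ) :
    ∃ c₁ ∈ cantorSet, ∃ c₂ ∈ cantorSet, ∃ k : ℕ, ∃ t ∈ cantorGap (2 * k + r),
      a < c₁ ∧ c₁ < t ∧ t < c₂ ∧ c₂ < b := by
  by_cases hc : ∃ c ∈ cantorSet, a < c ∧ c < b
  · obtain ⟨c, hc, h1, h2⟩ := hc
    exact exists_parity_cantorGap_near hc h1 h2 r
  -- Without Cantor points strictly between `a` and `b`, the function is locally constant on the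
  -- open interval, and continuity carries the value to both ends.
  · push Not at hc
    refine absurd ?_ h
    have hconst : ∀ x ∈ Set.Ioo a b, cantorFun x = cantorFun ((a + b) / 2) := fun x hx =>
      isPreconnected_Ioo.eq_of_eventually_eq
        (fun y hy => (cantorFun_eventually_eq fun h' =>
          absurd hy.2 (not_lt.2 (hc y h' hy.1))).filter_mono nhdsWithin_le_nhds)
        hx ⟨by linarith, by linarith⟩
    have hcl : ∀ x ∈ closure (Set.Ioo a b), cantorFun x = cantorFun ((a + b) / 2) := fun x hx =>
      closure_minimal (t := {x | cantorFun x = cantorFun ((a + b) / 2)}) hconst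
        (isClosed_eq continuous_cantorFun continuous_const) hx
    rw [closure_Ioo hab.ne] at hcl
    rw [hcl a ⟨le_rfl, hab.le⟩, hcl b ⟨hab.le, le_rfl⟩]

/-! ### Existence of oscillating circles -/

/-- The union of all gaps of the Cantor set. -/
def cantorGaps : Set ℝ := Set.Icc 0 1 \ cantorSet

theorem cantorGaps_eq : cantorGaps = Set.Ioo 0 1 \ cantorSet := by
  ext t
  constructor
  · rintro ⟨⟨h0, h1⟩, h⟩
    exact ⟨⟨lt_of_le_of_ne h0 fun h' => h (h' ▸ zero_mem_cantorSet),
      lt_of_le_of_ne h1 fun h' => h (h' ▸ one_mem_cantorSet)⟩, h⟩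
  · exact fun h => ⟨Set.Ioo_subset_Icc_self h.1, h.2⟩

theorem isOpen_cantorGaps : IsOpen cantorGaps := by
  rw [cantorGaps_eq]
  exact isOpen_Ioo.sdiff isClosed_cantorSet

theorem cantorGap_subset_cantorGaps {k : ℕ} : cantorGap k ⊆ cantorGaps := fun _ h =>
  ⟨cantorGap_subset_Icc h, notMem_cantorSet_of_mem_cantorGap h⟩

/-- This makes derivatives within the complement of the gaps unique, so a differentiable function
vanishing there has zero derivative there too. -/
theorem accPt_compl_cantorGaps {x : ℝ} (hx : x ∉ cantorGaps) : AccPt x (𝓟 cantorGapsᶜ) := by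
  rw [accPt_iff_frequently, Filter.frequently_iff]
  intro U hU
  obtain ⟨ε, hε, hU⟩ := Metric.mem_nhds_iff.1 hU
  by_cases hc : x ∈ cantorSet
  · obtain ⟨n, hn⟩ := exists_pow_lt_of_lt_one hε (by norm_num : (1 / 3 : ℝ) < 1)
    obtain ⟨c₁, h₁, c₂, h₂, t, _, h, h', h'', h'''⟩ := exists_cantorGap_near hc n
    have hU' : ∀ y, |y - x| < ε → y ∈ U := fun y hy => hU (by rwa [Metric.mem_ball, Real.dist_eq])
    by_cases h₃ : c₁ = x
    · exact ⟨c₂, hU' _ (by rw [abs_lt]; constructor <;> linarith), by linarith,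
        fun h => h.2 h₂⟩
    · exact ⟨c₁, hU' _ (by
        rw [abs_lt]
        have := (1 / 3 : ℝ) ^ n
        by_cases hx : x < c₁
        · constructor <;> linarith
        · constructor <;> linarith), h₃, fun h => h.2 h₁⟩
  · have hx' : x ∈ (Set.Icc (0 : ℝ) 1)ᶜ := fun h => hx ⟨h, hc⟩
    obtain ⟨δ, hδ, hV⟩ := Metric.isOpen_iff.1 isClosed_Icc.isOpen_compl x hx'
    have hm : 0 < min ε δ := lt_min hε hδ
    refine ⟨x + min ε δ / 2, hU ?_, by linarith, fun h => hV ?_ h.1⟩ <;>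
    · rw [Metric.mem_ball, Real.dist_eq, add_sub_cancel_left, abs_of_pos (by linarith)]
      linarith [min_le_left ε δ, min_le_right ε δ]

/-! ### Products of smooth functions with weights that are locally constant on the gaps -/

/-- A bounded function that is locally constant on the gaps of the Cantor set. -/
structure IsGapWeight (w : ℝ → ℝ) : Prop where
  bounded : ∃ M, ∀ t, |w t| ≤ M
  eventually_eq : ∀ t ∈ cantorGaps, ∀ᶠ s in 𝓝 t, w s = w t

theorem deriv_eq_zero_of_notMem_cantorGaps {g : ℝ → ℝ} (hg : Differentiable ℝ g)
    (h0 : ∀ t ∉ cantorGaps, g t = 0) {t : ℝ} (ht : t ∉ cantorGaps) : deriv g t = 0 := by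
  have h1 : HasDerivWithinAt g (deriv g t) cantorGapsᶜ t := (hg t).hasDerivAt.hasDerivWithinAt
  have h2 : HasDerivWithinAt g 0 cantorGapsᶜ t :=
    (hasDerivWithinAt_const t cantorGapsᶜ (0 : ℝ)).congr h0 (h0 t ht)
  exact (accPt_compl_cantorGaps ht).uniqueDiffWithinAt.eq_deriv _ h1 h2

/-- On a gap `w` is locally a constant factor. Elsewhere `g` and its derivative vanish, so `g` is
o(s - t), and a bounded factor does not change this. -/
theorem IsGapWeight.hasDerivAt_mul {w g : ℝ → ℝ} (hw : IsGapWeight w) (hg : Differentiable ℝ g)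
    (h0 : ∀ t ∉ cantorGaps, g t = 0) (t : ℝ) :
    HasDerivAt (fun s => w s * g s) (w t * deriv g t) t := by
  by_cases ht : t ∈ cantorGaps
  · refine ((hg t).hasDerivAt.const_mul (w t)).congr_of_eventuallyEq ?_
    filter_upwards [hw.eventually_eq t ht] with s hs
    rw [hs]
  · obtain ⟨M, hM⟩ := hw.bounded
    have hd := (hg t).hasDerivAt
    rw [deriv_eq_zero_of_notMem_cantorGaps hg h0 ht] at hd ⊢
    rw [hasDerivAt_iff_isLittleO] at hd ⊢
    simp only [h0 t ht, mul_zero, smul_zero, sub_zero] at hd ⊢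
    refine Asymptotics.IsBigO.trans_isLittleO ?_ hd
    refine Asymptotics.IsBigO.of_bound M (Eventually.of_forall fun s => ?_)
    rw [norm_mul]
    exact mul_le_mul_of_nonneg_right (hM s) (norm_nonneg _)

/-- The derivative is `w` times `deriv g`, and `deriv g` again vanishes off the gaps, so the
argument iterates. -/
theorem IsGapWeight.contDiff_mul {w g : ℝ → ℝ} (hw : IsGapWeight w) (hg : ContDiff ℝ ∞ g)
    (h0 : ∀ t ∉ cantorGaps, g t = 0) : ContDiff ℝ ∞ fun s => w s * g s := by
  rw [contDiff_infty]
  intro n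
  induction n generalizing g with
  | zero =>
    exact contDiff_zero.2 (continuous_iff_continuousAt.2 fun t =>
      (hw.hasDerivAt_mul (hg.differentiable (by simp)) h0 t).continuousAt)
  | succ n ih =>
    have hg' : Differentiable ℝ g := hg.differentiable (by simp)
    push_cast
    rw [contDiff_succ_iff_deriv]
    refine ⟨fun t => (hw.hasDerivAt_mul hg' h0 t).differentiableAt, by simp, ?_⟩
    rw [funext fun t => (hw.hasDerivAt_mul hg' h0 t).deriv]
    exact ih (contDiff_infty_iff_deriv.1 hg).2
      fun t ht => deriv_eq_zero_of_notMem_cantorGaps hg' h0 ht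

/-- The indicator function of the gaps of stages congruent to `r` modulo 2. -/
noncomputable def parityWeight (r : ℕ) : ℝ → ℝ :=
  Set.indicator {t | ∃ k, k % 2 = r ∧ t ∈ cantorGap k} 1

theorem parityWeight_of_mem {r k : ℕ} {t : ℝ} (ht : t ∈ cantorGap k) :
    parityWeight r t = if k % 2 = r then 1 else 0 := by
  have h : t ∈ {t | ∃ k, k % 2 = r ∧ t ∈ cantorGap k} ↔ k % 2 = r := by
    refine ⟨?_, fun h => ⟨k, h, ht⟩⟩
    rintro ⟨l, hl, h⟩
    rwa [cantorGap_unique ht h]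
  simp only [parityWeight, Set.indicator, h, Pi.one_apply]

theorem isGapWeight_parityWeight (r : ℕ) : IsGapWeight (parityWeight r) where
  bounded := ⟨1, fun t => by
    unfold parityWeight Set.indicator
    split_ifs <;> simp⟩
  eventually_eq t ht := by
    obtain ⟨k, hk⟩ := exists_mem_cantorGap ht.1.1 ht.1.2 ht.2
    filter_upwards [(isOpen_cantorGap k).mem_nhds hk] with s hs
    rw [parityWeight_of_mem hs, parityWeight_of_mem hk]

/-- The left endpoint of a gap, as a function on the gaps. -/
noncomputable def gapLeft (t : ℝ) : ℝ := sSup (cantorSet ∩ Set.Iic t)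

theorem bddAbove_cantorSet_inter (t : ℝ) : BddAbove (cantorSet ∩ Set.Iic t) :=
  ⟨t, fun _ h => h.2⟩

theorem gapLeft_eq_of_disjoint {s t : ℝ} (h : Disjoint (Set.uIcc s t) cantorSet) :
    gapLeft s = gapLeft t := by
  have : cantorSet ∩ Set.Iic s = cantorSet ∩ Set.Iic t := by
    ext c
    refine and_congr_right fun hc => ?_
    have hc' : c ∉ Set.uIcc s t := fun h' => Set.disjoint_left.1 h h' hc
    rw [Set.mem_uIcc] at hc'
    push Not at hc'
    simp only [Set.mem_Iic]
    constructor <;> intro h'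
    · by_contra! h''
      exact absurd h' (not_le.2 (hc'.2 h''.le))
    · by_contra! h''
      exact absurd h' (not_le.2 (hc'.1 h''.le))
  rw [gapLeft, gapLeft, this]

/-- A Cantor point c with s ≤ c ≤ t would give c ≤ `gapLeft t` = `gapLeft s` ≤ s, hence s = c, which
is not in a gap. -/
theorem disjoint_of_gapLeft_eq {s t : ℝ} (hs : s ∈ cantorGaps) (ht : t ∈ cantorGaps)
    (h : gapLeft s = gapLeft t) : Disjoint (Set.uIcc s t) cantorSet := by
  have key : ∀ s t, s ∈ cantorGaps → gapLeft s = gapLeft t → ∀ c ∈ cantorSet, s ≤ c → ¬ c ≤ t := by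
    intro s t hs h c hc hsc hct
    have h1 : c ≤ gapLeft t := le_csSup (bddAbove_cantorSet_inter t) ⟨hc, hct⟩
    have h2 : gapLeft s ≤ s := csSup_le ⟨0, zero_mem_cantorSet, hs.1.1⟩ fun _ h => h.2
    exact hs.2 ((show s = c by linarith) ▸ hc)
  rw [Set.disjoint_left]
  intro c hc hc'
  rcases Set.mem_uIcc.1 hc with h' | h'
  · exact key s t hs h c hc' h'.1 h'.2
  · exact key t s ht h.symm c hc' h'.1 h'.2

theorem isGapWeight_gapLeft : IsGapWeight gapLeft where
  bounded := ⟨1, fun t => by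
    have h0 : 0 ≤ gapLeft t := Real.sSup_nonneg fun c hc => (cantorSet_subset_unitInterval hc.1).1
    rw [abs_of_nonneg h0]
    exact Real.sSup_le (fun c hc => (cantorSet_subset_unitInterval hc.1).2) zero_le_one⟩
  eventually_eq t ht := by
    obtain ⟨ε, hε, h⟩ := Metric.isOpen_iff.1 isClosed_cantorSet.isOpen_compl t ht.2
    filter_upwards [Metric.ball_mem_nhds t hε] with s hs
    refine gapLeft_eq_of_disjoint (Set.disjoint_left.2 fun c hc => h ?_)
    have hs' := abs_lt.1 (Real.dist_eq s t ▸ Metric.mem_ball.1 hs)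
    rw [Metric.mem_ball, Real.dist_eq, abs_lt]
    rcases Set.mem_uIcc.1 hc with h' | h' <;> constructor <;> linarith [h'.1, h'.2]

/-! ### Assembling the periodic curve -/

/-- A smooth function supported in `[-2, 3]` extends to a smooth `6`-periodic function. -/
theorem exists_periodic_extension {f : ℝ → ℝ} (hf : ContDiff ℝ ∞ f)
    (h₁ : ∀ t ≤ -2, f t = 0) (h₂ : ∀ t, 3 ≤ t → f t = 0) :
    ∃ s : ℝ → ℝ, ContDiff ℝ ∞ s ∧ Function.Periodic s 6 ∧ ∀ t, -3 ≤ t → t ≤ 4 → s t = f t := by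
  have h6 : (0 : ℝ) < 6 := by norm_num
  -- The fundamental window is [-5/2, 7/2). As `f` vanishes outside (-2, 3), `s` agrees with `f`
  -- half a unit beyond both ends, which gives smoothness at the seams.
  let s : ℝ → ℝ := fun t => f (toIcoMod h6 (-5 / 2) t)
  have hper : Function.Periodic s 6 := fun t => by simp only [s, toIcoMod_add_right]
  have hs : ∀ t, -3 ≤ t → t ≤ 4 → s t = f t := by
    intro t h3 h4
    by_cases hl : t < -5 / 2
    · have : toIcoMod h6 (-5 / 2) t = t + 6 := by
        rw [← toIcoMod_add_right, toIcoMod_eq_self]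
        constructor <;> linarith
      simp only [s, this]
      rw [h₁ t (by linarith), h₂ _ (by linarith)]
    by_cases hr : 7 / 2 ≤ t
    · have : toIcoMod h6 (-5 / 2) t = t - 6 := by
        rw [← toIcoMod_sub, toIcoMod_eq_self]
        constructor <;> linarith
      simp only [s, this]
      rw [h₂ t (by linarith), h₁ _ (by linarith)]
    · have : toIcoMod h6 (-5 / 2) t = t := by
        rw [toIcoMod_eq_self]
        constructor <;> linarith
      simp only [s, this]
  refine ⟨s, contDiff_iff_contDiffAt.2 fun t => ?_, hper, hs⟩
  have hmem := toIcoMod_mem_Ico h6 (-5 / 2) t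
  have heq : toIcoMod h6 (-5 / 2) t = t - toIcoDiv h6 (-5 / 2) t * 6 := by
    rw [toIcoMod, zsmul_eq_mul]
  rw [heq] at hmem
  have hsm : ContDiff ℝ ∞ fun u => f (u - toIcoDiv h6 (-5 / 2) t * 6) :=
    hf.comp (contDiff_id.sub contDiff_const)
  refine hsm.contDiffAt.congr_of_eventuallyEq ?_
  filter_upwards [Metric.ball_mem_nhds t (by norm_num : (0 : ℝ) < 1 / 4)] with u hu
  have hu' := abs_lt.1 (Real.dist_eq u t ▸ Metric.mem_ball.1 hu)
  rw [← hs _ (by linarith [hmem.1]) (by linarith [hmem.2])]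
  exact (hper.sub_int_mul_eq _).symm

theorem fin_three_add_val (i k : Fin 3) :
    ((i + k : Fin 3) : ℕ) = i + k ∨ ((i + k : Fin 3) : ℕ) + 3 = i + k := by
  decide +revert

theorem fin_three_eq (i j : Fin 3) : j = i ∨ j = i + 1 ∨ j = i + 2 := by
  decide +revert

/-- The circle in `ℝ³` whose coordinates are translates of a single `6`-periodic function. -/
def cyclicCurve (s : ℝ → ℝ) (t : ℝ) (j : Fin 3) : ℝ := s (t - 2 * (j : ℕ))

theorem cyclicCurve_apply {s : ℝ → ℝ} (hs : Function.Periodic s 6) (i k : Fin 3) (t : ℝ) :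
    cyclicCurve s (2 * (i : ℕ) + t) (i + k) = s (t - 2 * (k : ℕ)) := by
  rw [cyclicCurve]
  rcases fin_three_add_val i k with h | h
  · rw [h]
    push_cast
    congr 1
    ring
  · have h' : (((i + k : Fin 3) : ℕ) : ℝ) = (i : ℕ) + (k : ℕ) - 3 := by
      rw [eq_sub_iff_add_eq]
      exact_mod_cast h
    rw [h', ← hs (t - 2 * (k : ℕ))]
    congr 1
    ring

theorem cornerPt_apply_self (i : Fin 3) : cornerPt i i = 1 := by simp [cornerPt]

theorem cornerPt_apply_add_one (i : Fin 3) : cornerPt i (i + 1) = 0 := by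
  simp [cornerPt]

theorem cornerPt_apply_add_two (i : Fin 3) : cornerPt i (i + 2) = 0 := by
  simp [cornerPt]

theorem cornerPt_add_one_apply_self (i : Fin 3) : cornerPt (i + 1) i = 0 := by
  simp [cornerPt]

theorem cornerPt_add_one_apply_add_two (i : Fin 3) : cornerPt (i + 1) (i + 2) = 0 :=
  Pi.single_eq_of_ne (by decide +revert) _

theorem funext_fin_three (i : Fin 3) {v w : Fin 3 → ℝ} (h0 : v i = w i)
    (h1 : v (i + 1) = w (i + 1)) (h2 : v (i + 2) = w (i + 2)) : v = w := by
  funext j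
  rcases fin_three_eq i j with rfl | rfl | rfl
  exacts [h0, h1, h2]

theorem nonempty_oscillatingCircle : Nonempty OscillatingCircle := by
  obtain ⟨B, hBs, hB, hBr⟩ := isOpen_cantorGaps.exists_contDiff_support_eq (n := ⊤)
  have hB0 : ∀ t ∉ cantorGaps, B t = 0 := fun t ht => by
    rw [← hBs] at ht
    exact Function.notMem_support.1 ht
  have hBpos : ∀ t ∈ cantorGaps, 0 < B t := fun t ht =>
    lt_of_le_of_ne (hBr ⟨t, rfl⟩).1 (Ne.symm (by rwa [← hBs] at ht))
  have hw : ∀ w, IsGapWeight w → ContDiff ℝ ∞ fun t => w t * B t := fun w h =>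
    h.contDiff_mul hB hB0
  have hB0' : ∀ t ≤ 0, B t = 0 := fun t ht => hB0 t fun h => by
    rw [cantorGaps_eq] at h
    linarith [h.1.1]
  have hB1' : ∀ t, 1 ≤ t → B t = 0 := fun t ht => hB0 t fun h => by
    rw [cantorGaps_eq] at h
    linarith [h.1.2]
  -- The history of one coordinate over a period: it rises on [-1, 0], stays near its own corner on
  -- [0, 1] with a perturbation that tells the gaps apart, and falls on [1, 2]. On [2, 3] and [-2,
  -- -1] the curve is at the next and the previous corner, where this coordinate is the one that is
  -- positive on even and on odd gaps respectively.
  let f : ℝ → ℝ := fun t => Real.smoothTransition (t + 1) - Real.smoothTransition (t - 1) +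
    gapLeft t * B t + parityWeight 0 (t - 2) * B (t - 2) + parityWeight 1 (t + 2) * B (t + 2)
  have hf : ContDiff ℝ ∞ f := by
    refine ((ContDiff.add (ContDiff.sub ?_ ?_) (hw _ isGapWeight_gapLeft)).add
      ((hw _ (isGapWeight_parityWeight 0)).comp (contDiff_id.sub contDiff_const))).add
      ((hw _ (isGapWeight_parityWeight 1)).comp (contDiff_id.add contDiff_const))
    · exact Real.smoothTransition.contDiff.comp (contDiff_id.add contDiff_const)
    · exact Real.smoothTransition.contDiff.comp (contDiff_id.sub contDiff_const)
  have T0 : ∀ {t : ℝ}, t ≤ 0 → Real.smoothTransition t = 0 :=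
    fun h => Real.smoothTransition.zero_of_nonpos h
  have T1 : ∀ {t : ℝ}, 1 ≤ t → Real.smoothTransition t = 1 :=
    fun h => Real.smoothTransition.one_of_one_le h
  obtain ⟨s, hs, hper, hsf⟩ := exists_periodic_extension hf
    (fun t ht => by
      simp only [f]
      rw [T0 (t := t + 1) (by linarith), T0 (t := t - 1) (by linarith), hB0' t (by linarith),
        hB0' (t - 2) (by linarith), hB0' (t + 2) (by linarith)]
      ring)
    (fun t ht => by
      simp only [f]
      rw [T1 (t := t + 1) (by linarith), T1 (t := t - 1) (by linarith), hB1' t (by linarith),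
        hB1' (t - 2) (by linarith), hB1' (t + 2) (by linarith)]
      ring)
  have v0 : ∀ i : Fin 3, ∀ t, 0 ≤ t → t ≤ 1 →
      cyclicCurve s (2 * (i : ℕ) + t) i = 1 + gapLeft t * B t := by
    intro i t h0 h1
    have := cyclicCurve_apply hper i 0 t
    rw [add_zero] at this
    rw [this]
    norm_num
    rw [hsf _ (by linarith) (by linarith)]
    simp only [f]
    rw [T1 (t := t + 1) (by linarith), T0 (t := t - 1) (by linarith),
        hB0' (t - 2) (by linarith), hB1' (t + 2) (by linarith)]
    ring
  have v1 : ∀ i : Fin 3, ∀ t, 0 ≤ t → t ≤ 1 →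
      cyclicCurve s (2 * (i : ℕ) + t) (i + 1) = parityWeight 1 t * B t := by
    intro i t h0 h1
    rw [cyclicCurve_apply hper i 1 t]
    norm_num
    rw [hsf _ (by linarith) (by linarith)]
    simp only [f]
    rw [T0 (t := t - 2 + 1) (by linarith), T0 (t := t - 2 - 1) (by linarith),
        hB0' (t - 2) (by linarith), hB0' (t - 2 - 2) (by linarith), sub_add_cancel]
    ring
  have v2 : ∀ i : Fin 3, ∀ t, 0 ≤ t → t ≤ 1 →
      cyclicCurve s (2 * (i : ℕ) + t) (i + 2) = parityWeight 0 t * B t := by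
    intro i t h0 h1
    rw [cyclicCurve_apply hper i 2 t, ← hper]
    norm_num
    rw [show t - 4 + 6 = t + 2 by ring, hsf _ (by linarith) (by linarith)]
    simp only [f]
    rw [T1 (t := t + 2 + 1) (by linarith), T1 (t := t + 2 - 1) (by linarith),
        hB1' (t + 2) (by linarith), hB1' (t + 2 + 2) (by linarith), add_sub_cancel_right]
    ring
  refine ⟨⟨cyclicCurve s, contDiff_pi.2 fun j => hs.comp (contDiff_id.sub contDiff_const),
    fun t => funext fun j => ?_, fun i => ⟨?_, ?_, ?_, ?_⟩, fun i => ?_⟩⟩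
  · rw [cyclicCurve, cyclicCurve, ← hper (t - _)]
    congr 1
    ring
  · intro t ht
    have hI := cantorSet_subset_unitInterval ht
    have hB := hB0 t fun h => h.2 ht
    refine funext_fin_three i ?_ ?_ ?_
    · rw [v0 i t hI.1 hI.2, hB, cornerPt_apply_self]
      ring
    · rw [v1 i t hI.1 hI.2, hB, cornerPt_apply_add_one]
      ring
    · rw [v2 i t hI.1 hI.2, hB, cornerPt_apply_add_two]
      ring
  · intro k hk t ht
    have hI := cantorGap_subset_Icc ht
    have hpos := hBpos t (cantorGap_subset_cantorGaps ht)
    rw [v1 i t hI.1 hI.2, v2 i t hI.1 hI.2, parityWeight_of_mem ht, parityWeight_of_mem ht,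
      Nat.even_iff.1 hk]
    simpa using hpos
  · intro k hk t ht
    have hI := cantorGap_subset_Icc ht
    have hpos := hBpos t (cantorGap_subset_cantorGaps ht)
    rw [v1 i t hI.1 hI.2, v2 i t hI.1 hI.2, parityWeight_of_mem ht, parityWeight_of_mem ht,
      Nat.odd_iff.1 hk]
    simpa using hpos
  · intro t ht t' ht' h
    obtain ⟨k, hk⟩ := exists_mem_cantorGap ht.1.1 ht.1.2 ht.2
    obtain ⟨k', hk'⟩ := exists_mem_cantorGap ht'.1.1 ht'.1.2 ht'.2
    have hp := hBpos t ht
    have hp' := hBpos t' ht'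
    have e0 := congrFun h i
    have e1 := congrFun h (i + 1)
    have e2 := congrFun h (i + 2)
    rw [v0 i t ht.1.1 ht.1.2, v0 i t' ht'.1.1 ht'.1.2] at e0
    rw [v1 i t ht.1.1 ht.1.2, v1 i t' ht'.1.1 ht'.1.2, parityWeight_of_mem hk,
      parityWeight_of_mem hk'] at e1
    rw [v2 i t ht.1.1 ht.1.2, v2 i t' ht'.1.1 ht'.1.2, parityWeight_of_mem hk,
      parityWeight_of_mem hk'] at e2
    -- On a gap exactly one of the coordinates `i + 1`, `i + 2` is nonzero and it equals `B`. Once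
    -- `B` is known, the coordinate `i` determines `gapLeft`, that is, the gap.
    have hB : B t = B t' := by
      rcases Nat.mod_two_eq_zero_or_one k with h | h <;>
      rcases Nat.mod_two_eq_zero_or_one k' with h' | h' <;> simp [h, h'] at e1 e2 <;> linarith
    rw [hB] at e0
    exact disjoint_of_gapLeft_eq ht ht' (mul_right_cancel₀ hp'.ne' (by linarith))
  · refine ⟨Real.smoothTransition, ?_, T0 le_rfl, T1 le_rfl, fun t ht => ?_⟩
    · exact Real.smoothTransition.monotone.monotoneOn _
    · have ht0 := ht.1
      have ht1 := ht.2
      refine funext_fin_three i ?_ ?_ ?_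
      · have := cyclicCurve_apply hper i 0 (1 + t)
        rw [add_zero, ← add_assoc] at this
        rw [this]
        norm_num [cornerPt_apply_self, cornerPt_add_one_apply_self]
        rw [hsf _ (by linarith) (by linarith)]
        simp only [f]
        rw [T1 (t := 1 + t + 1) (by linarith), hB1' (1 + t) (by linarith),
          hB0' (1 + t - 2) (by linarith), hB1' (1 + t + 2) (by linarith), add_sub_cancel_left]
        ring
      · have := cyclicCurve_apply hper i 1 (1 + t)
        rw [← add_assoc] at this
        rw [this]
        norm_num [cornerPt_apply_self, cornerPt_apply_add_one]
        rw [hsf _ (by linarith) (by linarith)]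
        simp only [f]
        rw [T0 (t := 1 + t - 2 - 1) (by linarith), hB0' (1 + t - 2) (by linarith),
          hB0' (1 + t - 2 - 2) (by linarith), hB1' (1 + t - 2 + 2) (by linarith),
          show 1 + t - 2 + 1 = t by ring]
        ring
      · have := cyclicCurve_apply hper i 2 (1 + t)
        rw [← add_assoc] at this
        rw [this, ← hper]
        norm_num [cornerPt_apply_add_two, cornerPt_add_one_apply_add_two]
        rw [show 1 + t - 4 + 6 = t + 3 by ring, hsf _ (by linarith) (by linarith)]
        simp only [f]
        rw [T1 (t := t + 3 + 1) (by linarith), T1 (t := t + 3 - 1) (by linarith),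
          hB1' (t + 3) (by linarith), hB1' (t + 3 - 2) (by linarith),
          hB1' (t + 3 + 2) (by linarith)]
        ring

/-! ### Points of an oscillating circle -/

namespace OscillatingCircle

variable (S : OscillatingCircle)

theorem toFun_of_mem_cantorSet {t : ℝ} (ht : t ∈ cantorSet) : S.toFun t = cornerPt 0 := by
  simpa using (S.oscillates 0).map_cantor t ht

theorem toFun_of_mem_even {k : ℕ} {t : ℝ} (ht : t ∈ cantorGap (2 * k + 0)) :
    S.toFun t 1 = 0 ∧ 0 < S.toFun t 2 := by
  simpa using (S.oscillates 0).map_even (2 * k) (even_two_mul k) t ht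

theorem toFun_of_mem_odd {k : ℕ} {t : ℝ} (ht : t ∈ cantorGap (2 * k + 1)) :
    S.toFun t 2 = 0 ∧ 0 < S.toFun t 1 := by
  simpa using (S.oscillates 0).map_odd (2 * k + 1) (odd_two_mul_add_one k) t ht

theorem disjoint_of_toFun_eq {t t' : ℝ} (ht : t ∈ cantorGaps) (ht' : t' ∈ cantorGaps)
    (h : S.toFun t = S.toFun t') : Disjoint (Set.uIcc t t') cantorSet :=
  (S.oscillates 0).disjoint t ht t' ht' (by simpa using h)

theorem toFun_segment (i : Fin 3) {t : ℝ} (h0 : 0 ≤ t) (h1 : t ≤ 1) :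
    S.toFun (2 * (i : ℕ) + 1 + t) (i + 2) = 0 := by
  obtain ⟨φ, -, -, -, h⟩ := S.segment i
  rw [h t ⟨h0, h1⟩]
  simp [cornerPt_apply_add_two, cornerPt_add_one_apply_add_two]

theorem toFun_outgoing {t : ℝ} (h1 : 1 ≤ t) (h2 : t ≤ 2) : S.toFun t 2 = 0 := by
  simpa using S.toFun_segment 0 (t := t - 1) (by linarith) (by linarith)

theorem toFun_incoming {t : ℝ} (h1 : -1 ≤ t) (h2 : t ≤ 0) : S.toFun t 1 = 0 := by
  have := S.toFun_segment 2 (t := t + 1) (by linarith) (by linarith)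
  rw [show (2 : Fin 3) + 2 = 1 from rfl] at this
  rw [← S.periodic t]
  convert this using 2
  norm_num
  ring

theorem toFun_sub_int (t : ℝ) (n : ℤ) : S.toFun (t - n * 6) = S.toFun t :=
  S.periodic.sub_int_mul_eq n

/-- Gaps and open segments are open sets of parameters, each mapped to one coordinate plane; the
endpoints of the segments belong to the translated Cantor sets. -/
theorem exists_eventually_or_cantor (t : ℝ) : (∃ i, ∀ᶠ s in 𝓝 t, S.toFun s i = 0) ∨
    ∃ (i : Fin 3) (n : ℤ), t - n * 6 - 2 * (i : ℕ) ∈ cantorSet := by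
  let n : ℤ := ⌊t / 6⌋
  have hn0 : 0 ≤ t - n * 6 := by linarith [Int.floor_le (t / 6)]
  have hn1 : t - n * 6 < 6 := by linarith [Int.lt_floor_add_one (t / 6)]
  obtain ⟨i, hi0, hi1⟩ : ∃ i : Fin 3, 0 ≤ t - n * 6 - 2 * (i : ℕ) ∧ t - n * 6 - 2 * (i : ℕ) < 2 := by
    rcases lt_or_ge (t - n * 6) 2 with h | h
    · exact ⟨0, by simpa using hn0, by simpa using h⟩
    rcases lt_or_ge (t - n * 6) 4 with h' | h'
    · exact ⟨1, by norm_num; linarith, by norm_num; linarith⟩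
    · exact ⟨2, by norm_num; linarith, by norm_num; linarith⟩
  have hS : ∀ s, S.toFun s = S.toFun (2 * (i : ℕ) + (s - n * 6 - 2 * (i : ℕ))) := fun s => by
    rw [add_sub_cancel, S.toFun_sub_int]
  have hc : Continuous fun s : ℝ => s - n * 6 - 2 * (i : ℕ) := by fun_prop
  by_cases hC : t - n * 6 - 2 * (i : ℕ) ∈ cantorSet
  · exact Or.inr ⟨i, n, hC⟩
  left
  rcases le_or_gt (t - n * 6 - 2 * (i : ℕ)) 1 with h | h
  · obtain ⟨k, hk⟩ := exists_mem_cantorGap hi0 h hC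
    have hev := hc.tendsto t ((isOpen_cantorGap k).mem_nhds hk)
    rcases Nat.even_or_odd k with he | he
    · refine ⟨i + 1, ?_⟩
      filter_upwards [hev] with s hs
      rw [hS]
      exact ((S.oscillates i).map_even k he _ hs).1
    · refine ⟨i + 2, ?_⟩
      filter_upwards [hev] with s hs
      rw [hS]
      exact ((S.oscillates i).map_odd k he _ hs).1
  · refine ⟨i + 2, ?_⟩
    filter_upwards [hc.tendsto t (Ioo_mem_nhds h hi1)] with s hs
    have := S.toFun_segment i (t := s - n * 6 - 2 * (i : ℕ) - 1) (by linarith [hs.1])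
      (by linarith [hs.2])
    rw [hS]
    convert this using 2
    ring

theorem exists_toFun_eq_zero (t : ℝ) : ∃ i, S.toFun t i = 0 := by
  rcases S.exists_eventually_or_cantor t with ⟨i, h⟩ | ⟨i, n, h⟩
  · exact ⟨i, h.self_of_nhds⟩
  · refine ⟨i + 1, ?_⟩
    have := (S.oscillates i).map_cantor _ h
    rw [add_sub_cancel, S.toFun_sub_int] at this
    rw [this, cornerPt_apply_add_one]

/-- The Cantor sets at the other two corners are sent to points different from e₀, and the window
(-2, 6) meets no translate of `cantorSet` by a nonzero multiple of 6. -/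
theorem exists_eventually_of_notMem {t : ℝ} (ht : t ∈ Set.Ioo (-2) 6) (hC : t ∉ cantorSet)
    (hS : S.toFun t = cornerPt 0) : ∃ i, ∀ᶠ s in 𝓝 t, S.toFun s i = 0 := by
  rcases S.exists_eventually_or_cantor t with h | ⟨i, n, h⟩
  · exact h
  exfalso
  have h' := (S.oscillates i).map_cantor _ h
  rw [add_sub_cancel, S.toFun_sub_int, hS] at h'
  have hi : i = 0 := by
    by_contra hi
    have := congrFun h' i
    rw [cornerPt_apply_self, cornerPt, Pi.single_eq_of_ne hi] at this
    exact zero_ne_one this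
  subst hi
  have hI := cantorSet_subset_unitInterval h
  simp only [Fin.val_zero, Nat.cast_zero, mul_zero, sub_zero] at hI h
  have hn0 : -1 < n := by
    have : (-1 : ℝ) < n := by linarith [hI.2, ht.1]
    exact_mod_cast this
  have hn1 : n < 1 := by
    have : (n : ℝ) < 1 := by linarith [hI.1, ht.2]
    exact_mod_cast this
  obtain rfl : n = 0 := by omega
  exact hC (by simpa using h)

/-! ### Local primitives -/

variable {X : Type*} [TopologicalSpace X]

/-- A function `g` is a primitive on `N` of a map `p` to `ℝ³` which is either contained in a
coordinate plane, in which case `g` is constant, or factors through the circle, in which case `g`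
is given by the Cantor function up to a constant. -/
def LocalPrimitive (p : X → Fin 3 → ℝ) (N : Set X) (g : X → ℝ) : Prop :=
  ((∃ i, ∀ y ∈ N, p y i = 0) ∧ ∃ c, ∀ y ∈ N, g y = c) ∨
    ∃ u : X → ℝ, ContinuousOn u N ∧ (∀ y ∈ N, u y ∈ Set.Ioo (-2) 6 ∧ p y = S.toFun (u y)) ∧
      ∃ c, ∀ y ∈ N, g y = cantorFun (u y) + c

variable {S}

theorem LocalPrimitive.mono {p : X → Fin 3 → ℝ} {N M : Set X} {g : X → ℝ}
    (h : S.LocalPrimitive p N g) (hM : M ⊆ N) : S.LocalPrimitive p M g := by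
  rcases h with ⟨⟨i, hi⟩, c, hc⟩ | ⟨u, hu, hp, c, hc⟩
  · exact Or.inl ⟨⟨i, fun y hy => hi y (hM hy)⟩, c, fun y hy => hc y (hM hy)⟩
  · exact Or.inr ⟨u, hu.mono hM, fun y hy => hp y (hM hy), c, fun y hy => hc y (hM hy)⟩

theorem LocalPrimitive.congr {p : X → Fin 3 → ℝ} {N : Set X} {g g' : X → ℝ} {d : ℝ}
    (h : S.LocalPrimitive p N g) (hg : ∀ y ∈ N, g' y = g y + d) : S.LocalPrimitive p N g' := by
  rcases h with ⟨hi, c, hc⟩ | ⟨u, hu, hp, c, hc⟩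
  · exact Or.inl ⟨hi, c + d, fun y hy => by rw [hg y hy, hc y hy]⟩
  · exact Or.inr ⟨u, hu, hp, c + d, fun y hy => by rw [hg y hy, hc y hy, add_assoc]⟩

theorem LocalPrimitive.comp {Y : Type*} [TopologicalSpace Y] {f : Y → X} (hf : Continuous f)
    {p : X → Fin 3 → ℝ} {N : Set X} {g : X → ℝ}
    (h : S.LocalPrimitive p N g) : S.LocalPrimitive (p ∘ f) (f ⁻¹' N) (g ∘ f) := by
  rcases h with ⟨⟨i, hi⟩, c, hc⟩ | ⟨u, hu, hp, c, hc⟩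
  · exact Or.inl ⟨⟨i, fun y hy => hi _ hy⟩, c, fun y hy => hc _ hy⟩
  · exact Or.inr ⟨u ∘ f, hu.comp hf.continuousOn (Set.mapsTo_preimage _ _),
      fun y hy => hp _ hy, c, fun y hy => hc _ hy⟩

/-! ### Uniqueness of local primitives up to a constant -/

variable (S)

theorem mem_cantorSet_of_not_eventually {N : Set X} (hN : IsOpen N) {u : X → ℝ}
    (hu : ContinuousOn u N) {x : X} (hx : x ∈ N)
    (h : ¬ ∀ᶠ y in 𝓝 x, cantorFun (u y) = cantorFun (u x)) : u x ∈ cantorSet := by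
  by_contra hC
  exact h ((hu.continuousAt (hN.mem_nhds hx)).eventually (cantorFun_eventually_eq hC))

/-- The image under `u` of a small connected neighbourhood is an interval on which the Cantor
function varies. The points `y₁`, `y₂` enclose the gap of `u y`, so that the whole gap is close to
`u x`. -/
theorem exists_cantorGap_of_not_eventually [LocallyConnectedSpace X] {N : Set X} (hN : IsOpen N)
    {u : X → ℝ} (hu : ContinuousOn u N) {x : X} (hx : x ∈ N)
    (h : ¬ ∀ᶠ y in 𝓝 x, cantorFun (u y) = cantorFun (u x)) {V : Set X} (hV : V ∈ 𝓝 x) (r : ℕ) :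
    ∃ y ∈ V, ∃ y₁ ∈ V, ∃ y₂ ∈ V, ∃ k, u y ∈ cantorGap (2 * k + r) ∧ u y₁ ∈ cantorSet ∧
      u y₂ ∈ cantorSet ∧ u y₁ < u y ∧ u y < u y₂ := by
  obtain ⟨W, hWV, hWo, hxW, hWc⟩ := locallyConnectedSpace_iff_subsets_isOpen_isConnected.1
    ‹LocallyConnectedSpace X› x _ (inter_mem hV (hN.mem_nhds hx))
  obtain ⟨z, hz, hne⟩ : ∃ z ∈ W, cantorFun (u z) ≠ cantorFun (u x) := by
    by_contra! h'
    exact h (eventually_of_mem (hWo.mem_nhds hxW) h')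
  have hord : (u '' W).OrdConnected :=
    (hWc.isPreconnected.image u (hu.mono fun y hy => (hWV hy).2)).ordConnected
  have key : ∀ a ∈ u '' W, ∀ b ∈ u '' W, a < b → cantorFun a ≠ cantorFun b →
      ∃ y ∈ V, ∃ y₁ ∈ V, ∃ y₂ ∈ V, ∃ k, u y ∈ cantorGap (2 * k + r) ∧ u y₁ ∈ cantorSet ∧
      u y₂ ∈ cantorSet ∧ u y₁ < u y ∧ u y < u y₂ := by
    intro a ha b hb hab hne
    obtain ⟨c₁, h₁, c₂, h₂, k, t, ht, h3, h4, h5, h6⟩ :=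
      exists_cantorGap_of_cantorFun_ne hab hne r
    obtain ⟨y₁, hy₁, rfl⟩ := hord.out ha hb ⟨h3.le, by linarith⟩
    obtain ⟨y₂, hy₂, rfl⟩ := hord.out ha hb ⟨(by linarith), h6.le⟩
    obtain ⟨y, hy, rfl⟩ := hord.out ha hb (show t ∈ Set.Icc a b from ⟨by linarith, by linarith⟩)
    exact ⟨y, (hWV hy).1, y₁, (hWV hy₁).1, y₂, (hWV hy₂).1, k, ht, h₁, h₂, h4, h5⟩
  rcases lt_or_gt_of_ne (fun h' => hne (congrArg _ h') : u z ≠ u x) with h' | h'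
  · exact key _ ⟨z, hz, rfl⟩ _ ⟨x, hxW, rfl⟩ h' hne
  · exact key _ ⟨x, hxW, rfl⟩ _ ⟨z, hz, rfl⟩ h' hne.symm

/-- Each plane is ruled out separately: the point itself is e₀, where coordinate 0 is 1; nearby odd
gaps have positive coordinate 1, and nearby even gaps have positive coordinate 2. -/
theorem not_eventually_eq_zero [LocallyConnectedSpace X] {N : Set X} (hN : IsOpen N)
    {u : X → ℝ} (hu : ContinuousOn u N) {x : X} (hx : x ∈ N)
    (h : ¬ ∀ᶠ y in 𝓝 x, cantorFun (u y) = cantorFun (u x)) (i : Fin 3) :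
    ¬ ∀ᶠ y in 𝓝 x, S.toFun (u y) i = 0 := by
  intro hi
  fin_cases i
  · have := hi.self_of_nhds
    rw [S.toFun_of_mem_cantorSet (mem_cantorSet_of_not_eventually hN hu hx h)] at this
    simp [cornerPt] at this
  · obtain ⟨y, hy, -, -, -, -, k, hk, -⟩ :=
      exists_cantorGap_of_not_eventually hN hu hx h hi 1
    exact (S.toFun_of_mem_odd hk).2.ne' hy
  · obtain ⟨y, hy, -, -, -, -, k, hk, -⟩ :=
      exists_cantorGap_of_not_eventually hN hu hx h hi 0
    exact (S.toFun_of_mem_even hk).2.ne' hy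

/-- If the Cantor function is not locally constant at a point along a lift to the line of a map to
the circle, then any other lift agrees with this one there. -/
theorem eq_of_not_eventually [LocallyConnectedSpace X] {N : Set X} (hN : IsOpen N)
    {u w : X → ℝ} (hu : ContinuousOn u N) (hw : ContinuousOn w N)
    (hw' : ∀ y ∈ N, w y ∈ Set.Ioo (-2) 6)
    (huw : ∀ y ∈ N, S.toFun (u y) = S.toFun (w y)) {x : X} (hx : x ∈ N)
    (h : ¬ ∀ᶠ y in 𝓝 x, cantorFun (u y) = cantorFun (u x)) : u x = w x := by
  have huC := mem_cantorSet_of_not_eventually hN hu hx h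
  have huS := S.toFun_of_mem_cantorSet huC
  have hNx := hN.mem_nhds hx
  -- Otherwise the circle would stay in a plane near `w x`, hence also along `u`.
  have hwC : w x ∈ cantorSet := by
    by_contra hC
    obtain ⟨i, hi⟩ := S.exists_eventually_of_notMem (hw' x hx) hC ((huw x hx).symm.trans huS)
    refine S.not_eventually_eq_zero hN hu hx h i ?_
    filter_upwards [(hw.continuousAt hNx).eventually hi, hNx] with y hy hyN
    rw [huw y hyN, hy]
  by_contra hne
  -- The first bound makes the `ε`-balls around `u x` and `w x` disjoint; the second prevents `w`
  -- from reaching both sides of [0, 1] within `ε` of `w x`.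
  let ε := min (|u x - w x| / 2) (1 / 2)
  have hε : 0 < ε := lt_min (half_pos (abs_pos.2 (sub_ne_zero.2 hne))) (by norm_num)
  have hεd : ε ≤ |u x - w x| / 2 := min_le_left _ _
  have hεh : ε ≤ 1 / 2 := min_le_right _ _
  have hV : {y | y ∈ N ∧ |u y - u x| < ε ∧ |w y - w x| < ε} ∈ 𝓝 x := by
    filter_upwards [hNx, (hu.continuousAt hNx).eventually (Metric.ball_mem_nhds _ hε),
      (hw.continuousAt hNx).eventually (Metric.ball_mem_nhds _ hε)] with y h1 h2 h3
    exact ⟨h1, h2, h3⟩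
  have hwI := cantorSet_subset_unitInterval hwC
  -- If `w y` were in a gap, it would be the gap of `u y`, since different gaps have disjoint
  -- images. Then `w y` would lie between `u y₁` and `u y₂`, too close to `u x`.
  have key : ∀ r, ∃ y, y ∈ N ∧ |w y - w x| < ε ∧ ∃ k, u y ∈ cantorGap (2 * k + r) ∧
      (w y ∈ cantorSet ∨ w y ≤ 0 ∨ 1 ≤ w y) := by
    intro r
    obtain ⟨y, hy, y₁, hy₁, y₂, hy₂, k, hk, h₁, h₂, hlt₁, hlt₂⟩ :=
      exists_cantorGap_of_not_eventually hN hu hx h hV r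
    refine ⟨y, hy.1, hy.2.2, k, hk, ?_⟩
    by_contra! hcon
    have hd := Set.disjoint_left.1 (S.disjoint_of_toFun_eq (cantorGap_subset_cantorGaps hk)
      ⟨⟨hcon.2.1.le, hcon.2.2.le⟩, hcon.1⟩ (huw y hy.1))
    have hd₁ : u y₁ < w y := by
      by_contra! h'
      exact hd (Set.mem_uIcc.2 (Or.inr ⟨h', hlt₁.le⟩)) h₁
    have hd₂ : w y < u y₂ := by
      by_contra! h'
      exact hd (Set.mem_uIcc.2 (Or.inl ⟨hlt₂.le, h'⟩)) h₂
    have a1 := abs_lt.1 hy₁.2.1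
    have a2 := abs_lt.1 hy₂.2.1
    have a3 := abs_lt.1 hy.2.2
    rcases abs_cases (u x - w x) with ⟨h', _⟩ | ⟨h', _⟩ <;> linarith
  obtain ⟨y, hyN, hy, k, hk, hye⟩ := key 0
  obtain ⟨z, hzN, hz, l, hl, hzo⟩ := key 1
  have ay := abs_lt.1 hy
  have az := abs_lt.1 hz
  -- Coordinate 2 is positive at `y`, but it vanishes at e₀ and on the outgoing segment, so `w y` is
  -- on the incoming side. For `z` coordinate 1 forces the outgoing side.
  have hy' : w y ≤ 0 := by
    have hpos := (S.toFun_of_mem_even hk).2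
    rw [huw y hyN] at hpos
    rcases hye with h' | h' | h'
    · rw [S.toFun_of_mem_cantorSet h'] at hpos
      simp [cornerPt] at hpos
    · exact h'
    · rw [S.toFun_outgoing h' (by linarith [hwI.2])] at hpos
      exact absurd hpos (lt_irrefl _)
  have hz' : 1 ≤ w z := by
    have hpos := (S.toFun_of_mem_odd hl).2
    rw [huw z hzN] at hpos
    rcases hzo with h' | h' | h'
    · rw [S.toFun_of_mem_cantorSet h'] at hpos
      simp [cornerPt] at hpos
    · rw [S.toFun_incoming (by linarith [hwI.1]) h'] at hpos
      exact absurd hpos (lt_irrefl _)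
    · exact h'
  linarith

variable {S}

theorem cantorFun_comp_eq_of_plane [LocallyConnectedSpace X] {N : Set X} (hN : IsOpen N)
    (hc : IsPreconnected N) {u : X → ℝ} (hu : ContinuousOn u N) {i : Fin 3}
    (hi : ∀ y ∈ N, S.toFun (u y) i = 0) {x y : X} (hx : x ∈ N) (hy : y ∈ N) :
    cantorFun (u x) = cantorFun (u y) :=
  hc.eq_of_eventually_eq (f := fun z => cantorFun (u z)) (fun z hz => by
    by_contra h
    refine S.not_eventually_eq_zero hN hu hz (fun h' => h (h'.filter_mono nhdsWithin_le_nhds)) i ?_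
    exact eventually_of_mem (hN.mem_nhds hz) hi) hx hy

/-- Where the difference `D` is nonzero the lifts differ, so by `eq_of_not_eventually` neither
Cantor function varies and `D` is locally constant. By continuity a nonzero level set of `D` is then
open and closed in `N`. -/
theorem cantorFun_comp_sub_eq [LocallyConnectedSpace X] {N : Set X} (hN : IsOpen N)
    (hc : IsPreconnected N) {u w : X → ℝ} (hu : ContinuousOn u N) (hw : ContinuousOn w N)
    (hu' : ∀ y ∈ N, u y ∈ Set.Ioo (-2) 6) (hw' : ∀ y ∈ N, w y ∈ Set.Ioo (-2) 6)
    (huw : ∀ y ∈ N, S.toFun (u y) = S.toFun (w y)) {x y : X} (hx : x ∈ N) (hy : y ∈ N) :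
    cantorFun (u x) - cantorFun (w x) = cantorFun (u y) - cantorFun (w y) := by
  let D : X → ℝ := fun z => cantorFun (u z) - cantorFun (w z)
  have hD : ContinuousOn D N :=
    (continuous_cantorFun.comp_continuousOn hu).sub (continuous_cantorFun.comp_continuousOn hw)
  have hloc : ∀ z ∈ N, D z ≠ 0 → ∀ᶠ z' in 𝓝 z, D z' = D z := by
    intro z hz hne
    have hne' : u z ≠ w z := fun h => hne (by simp only [D, h, sub_self])
    have h1 : ∀ᶠ z' in 𝓝 z, cantorFun (u z') = cantorFun (u z) := by
      by_contra h
      exact hne' (S.eq_of_not_eventually hN hu hw hw' huw hz h)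
    have h2 : ∀ᶠ z' in 𝓝 z, cantorFun (w z') = cantorFun (w z) := by
      by_contra h
      exact hne' (S.eq_of_not_eventually hN hw hu hu' (fun y hy => (huw y hy).symm) hz h).symm
    filter_upwards [h1, h2] with z' h1 h2
    simp only [D, h1, h2]
  change D x = D y
  by_cases hzero : ∀ z ∈ N, D z = 0
  · rw [hzero x hx, hzero y hy]
  push Not at hzero
  obtain ⟨a, ha, hne⟩ := hzero
  have ind1 : ∀ b, D b = D a → Set.indicator {z | D z = D a} (1 : X → ℝ) b = 1 := fun b h =>
    Set.indicator_of_mem (s := {z | D z = D a}) h _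
  have ind0 : ∀ b, D b ≠ D a → Set.indicator {z | D z = D a} (1 : X → ℝ) b = 0 := fun b h =>
    Set.indicator_of_notMem (s := {z | D z = D a}) h _
  have hlevel : ∀ z ∈ N, D z = D a := by
    intro z hz
    have := hc.eq_of_eventually_eq (f := Set.indicator {z | D z = D a} 1) (fun b hb => by
      by_cases hb0 : D b = 0
      · have hev : ∀ᶠ b' in 𝓝 b, D b' ≠ D a :=
          (hD.continuousAt (hN.mem_nhds hb)).eventually_ne (by rw [hb0]; exact hne.symm)
        filter_upwards [hev.filter_mono (nhdsWithin_le_nhds (s := N))] with b' hb'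
        rw [ind0 b' hb', ind0 b (by rw [hb0]; exact hne.symm)]
      · filter_upwards [(hloc b hb hb0).filter_mono nhdsWithin_le_nhds] with b' hb'
        by_cases h : D b = D a
        · rw [ind1 b h, ind1 b' (hb'.trans h)]
        · rw [ind0 b h, ind0 b' (hb'.trans_ne h)]) hz ha
    by_contra h
    rw [ind0 z h, ind1 a rfl] at this
    exact zero_ne_one this
  rw [hlevel x hx, hlevel y hy]

theorem LocalPrimitive.sub_eq [LocallyConnectedSpace X] {p : X → Fin 3 → ℝ} {N : Set X}
    (hN : IsOpen N) (hc : IsPreconnected N) {g g' : X → ℝ} (hg : S.LocalPrimitive p N g)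
    (hg' : S.LocalPrimitive p N g') {x y : X} (hx : x ∈ N) (hy : y ∈ N) :
    g x - g' x = g y - g' y := by
  rcases hg with ⟨⟨i, hi⟩, c, hgc⟩ | ⟨u, hu, hp, c, hgc⟩ <;>
  rcases hg' with ⟨⟨j, hj⟩, d, hgd⟩ | ⟨w, hw, hq, d, hgd⟩ <;>
  rw [hgc x hx, hgc y hy, hgd x hx, hgd y hy]
  · rw [cantorFun_comp_eq_of_plane (S := S) hN hc hw (fun z hz => (hq z hz).2 ▸ hi z hz) hx hy]
  · rw [cantorFun_comp_eq_of_plane (S := S) hN hc hu (fun z hz => (hp z hz).2 ▸ hj z hz) hx hy]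
  · have := cantorFun_comp_sub_eq (S := S) hN hc hu hw (fun z hz => (hp z hz).1)
      (fun z hz => (hq z hz).1) (fun z hz => (hp z hz).2.symm.trans (hq z hz).2) hx hy
    linarith

variable (S)

/-- A primitive of a map to `ℝ³` is a function that is locally a primitive. -/
def IsPrimitive (p : X → Fin 3 → ℝ) (g : X → ℝ) : Prop :=
  ∀ x, ∃ N ∈ 𝓝 x, S.LocalPrimitive p N g

variable {S}

theorem IsPrimitive.comp {Y : Type*} [TopologicalSpace Y] {f : Y → X} (hf : Continuous f)
    {p : X → Fin 3 → ℝ} {g : X → ℝ} (h : S.IsPrimitive p g) : S.IsPrimitive (p ∘ f) (g ∘ f) := by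
  intro y
  obtain ⟨N, hN, h⟩ := h (f y)
  exact ⟨_, hf.continuousAt.preimage_mem_nhds hN, h.comp hf⟩

theorem IsPrimitive.sub_eq [LocallyConnectedSpace X] [PreconnectedSpace X] {p : X → Fin 3 → ℝ}
    {g g' : X → ℝ} (hg : S.IsPrimitive p g) (hg' : S.IsPrimitive p g') (x y : X) :
    g x - g' x = g y - g' y := by
  refine isPreconnected_univ.eq_of_eventually_eq (f := fun z => g z - g' z) (fun z _ => ?_)
    (Set.mem_univ x) (Set.mem_univ y)
  obtain ⟨N, hN, h⟩ := hg z
  obtain ⟨N', hN', h'⟩ := hg' z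
  obtain ⟨W, hW, hWo, hzW, hWc⟩ := locallyConnectedSpace_iff_subsets_isOpen_isConnected.1
    ‹LocallyConnectedSpace X› z _ (inter_mem hN hN')
  refine Filter.Eventually.filter_mono nhdsWithin_le_nhds
    (eventually_of_mem (hWo.mem_nhds hzW) fun y hy => ?_)
  exact (h.mono fun a ha => (hW ha).1).sub_eq hWo hWc.isPreconnected
    (h'.mono fun a ha => (hW ha).2) hy hzW

end OscillatingCircle

/-! ### Existence of primitives -/

/-- Needed to compare local primitives on overlaps of balls, where uniqueness requires
connectedness. -/
theorem Convex.isPreconnected_ball_inter_ball {E : Type*} [NormedAddCommGroup E] [NormedSpace ℝ E]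
    {s : Set E} (hs : Convex ℝ s) (x y : s) (r : ℝ) :
    IsPreconnected (Metric.ball x r ∩ Metric.ball y r) := by
  rw [← Topology.IsInducing.subtypeVal.isPreconnected_image]
  have : Subtype.val '' (Metric.ball x r ∩ Metric.ball y r) =
      Metric.ball (x : E) r ∩ Metric.ball (y : E) r ∩ s := by
    ext z
    constructor
    · rintro ⟨z, hz, rfl⟩
      exact ⟨hz, z.2⟩
    · rintro ⟨hz, hzs⟩
      exact ⟨⟨z, hzs⟩, hz, rfl⟩
  rw [this]
  exact (((convex_ball _ _).inter (convex_ball _ _)).inter hs).isPreconnected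

/-- On a compact convex set, a function `inc` on pairs of close points that satisfies the cocycle
condition is given by the differences of a function. -/
theorem exists_primitive_of_cocycle {E : Type*} [NormedAddCommGroup E] [NormedSpace ℝ E]
    {s : Set E} (hs : Convex ℝ s) (hc : IsCompact s) {δ : ℝ} (hδ : 0 < δ) (inc : s → s → ℝ)
    (hinc : ∀ x y z, dist x y < δ → dist x z < δ → dist y z < δ →
      inc x y + inc y z = inc x z) :
    ∃ h : s → ℝ, ∀ x y, dist x y < δ / 2 → h y - h x = inc x y := by
  rcases isEmpty_or_nonempty s with he | ⟨p₀, hp₀⟩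
  · exact ⟨fun _ => 0, fun x => he.elim x⟩
  obtain ⟨D, hD⟩ := Metric.isBounded_iff.1 hc.isBounded
  obtain ⟨n, hn⟩ := exists_nat_gt (max 0 (D / (δ / 2)))
  have hn0 : (0 : ℝ) < n := (le_max_left _ _).trans_lt hn
  have hnD : D / n < δ / 2 := by
    have := (le_max_right _ _).trans_lt hn
    rw [div_lt_iff₀ (half_pos hδ)] at this
    rw [div_lt_iff₀ hn0]
    linarith
  -- For `k` from 0 to `n` the points `P k x` run along the segment from `p₀` to `x`; the minimum
  -- keeps them in `s` for larger `k`. The primitive sums `inc` over these steps.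
  let τ : ℕ → ℝ := fun k => min 1 (k / n)
  have hτ0 : ∀ k, 0 ≤ τ k := fun k => le_min zero_le_one (by positivity)
  have hτ1 : ∀ k, τ k ≤ 1 := fun k => min_le_left _ _
  have hτd : ∀ k, |τ k - τ (k + 1)| ≤ 1 / n := by
    intro k
    refine (abs_min_sub_min_le_max _ _ _ _).trans (max_le (by simp) ?_)
    push_cast
    rw [add_div, ← sub_sub, sub_self, zero_sub, abs_neg, abs_of_nonneg (by positivity)]
  let P : ℕ → s → s := fun k x => ⟨(1 - τ k) • p₀ + τ k • (x : E),
    hs hp₀ x.2 (sub_nonneg.2 (hτ1 k)) (hτ0 k) (by ring)⟩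
  have hPd : ∀ k x y, dist (P k x) (P k y) ≤ dist x y := by
    intro k x y
    rw [Subtype.dist_eq, Subtype.dist_eq]
    simp only [P, dist_add_left, dist_smul₀, Real.norm_eq_abs, abs_of_nonneg (hτ0 k)]
    exact mul_le_of_le_one_left dist_nonneg (hτ1 k)
  have hPs : ∀ k x, dist (P k x) (P (k + 1) x) < δ / 2 := by
    intro k x
    have e : (P k x : E) - P (k + 1) x = (τ k - τ (k + 1)) • ((x : E) - p₀) := by
      simp only [P]
      module
    rw [Subtype.dist_eq, dist_eq_norm, e, norm_smul, Real.norm_eq_abs]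
    refine lt_of_le_of_lt ?_ hnD
    calc |τ k - τ (k + 1)| * ‖(x : E) - p₀‖ ≤ 1 / n * D :=
          mul_le_mul (hτd k) (dist_eq_norm (x : E) p₀ ▸ hD x.2 hp₀) (norm_nonneg _) (by positivity)
      _ = D / n := by ring
  have hP0 : ∀ x, P 0 x = ⟨p₀, hp₀⟩ := fun x => Subtype.ext (by simp [P, τ])
  have hPn : ∀ x, P n x = x := fun x => Subtype.ext (by simp [P, τ, div_self hn0.ne'])
  refine ⟨fun x => ∑ k ∈ Finset.range n, inc (P k x) (P (k + 1) x), fun x y hxy => ?_⟩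
  have h00 : inc ⟨p₀, hp₀⟩ ⟨p₀, hp₀⟩ = 0 := by
    have := hinc ⟨p₀, hp₀⟩ ⟨p₀, hp₀⟩ ⟨p₀, hp₀⟩ (by simpa) (by simpa) (by simpa)
    linarith
  -- The quadrilateral between consecutive steps towards `x` and `y` has sides and one diagonal
  -- shorter than `δ`; the cocycle condition on its two triangles makes the difference of the sums
  -- telescope.
  have hstep : ∀ k, inc (P k y) (P (k + 1) y) - inc (P k x) (P (k + 1) x) =
      inc (P (k + 1) x) (P (k + 1) y) - inc (P k x) (P k y) := by
    intro k
    have hd : dist (P k x) (P (k + 1) y) < δ :=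
      (dist_triangle _ (P (k + 1) x) _).trans_lt
        (by linarith [hPs k x, hPd (k + 1) x y])
    have h1 := hinc (P k x) (P (k + 1) x) (P (k + 1) y) (by linarith [hPs k x]) hd
      (by linarith [hPd (k + 1) x y])
    have h2 := hinc (P k x) (P k y) (P (k + 1) y) (by linarith [hPd k x y]) hd
      (by linarith [hPs k y])
    linarith
  dsimp only
  rw [← Finset.sum_sub_distrib, Finset.sum_congr rfl fun k _ => hstep k,
    Finset.sum_range_sub (fun k => inc (P k x) (P k y)), hPn, hPn, hP0, hP0, h00, sub_zero]

namespace OscillatingCircle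

variable {S : OscillatingCircle}

/-- By compactness there are local primitives on all balls of one radius `δ`. Uniqueness on overlaps
says exactly that their increments satisfy the cocycle condition. -/
theorem exists_isPrimitive {E : Type*} [NormedAddCommGroup E] [NormedSpace ℝ E] {s : Set E}
    (hs : Convex ℝ s) (hc : IsCompact s) {p : s → Fin 3 → ℝ}
    (hp : ∀ x, ∃ N ∈ 𝓝 x, ∃ g, S.LocalPrimitive p N g) : ∃ h, S.IsPrimitive p h := by
  have := hs.locallyPathConnectedSpace
  have := isCompact_iff_compactSpace.1 hc
  choose N hN g hg using hp
  obtain ⟨δ, hδ, hδN⟩ := lebesgue_number_lemma_of_metric (isCompact_univ (X := s))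
    (c := fun x => interior (N x)) (fun x => isOpen_interior)
    (fun x _ => Set.mem_iUnion.2 ⟨x, mem_interior_iff_mem_nhds.2 (hN x)⟩)
  have hG : ∀ x : s, ∃ G, S.LocalPrimitive p (Metric.ball x δ) G := fun x => by
    obtain ⟨i, hi⟩ := hδN x (Set.mem_univ x)
    exact ⟨g i, (hg i).mono (hi.trans interior_subset)⟩
  choose G hG using hG
  obtain ⟨h, hh⟩ := exists_primitive_of_cocycle hs hc hδ (fun x y => G x y - G x x) (by
    intro x y z hxy hxz hyz
    have := ((hG x).mono (Set.inter_subset_left (t := Metric.ball y δ))).sub_eq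
      (Metric.isOpen_ball.inter Metric.isOpen_ball) (hs.isPreconnected_ball_inter_ball x y δ)
      ((hG y).mono Set.inter_subset_right) (x := y) (y := z)
      ⟨by rwa [Metric.mem_ball'], Metric.mem_ball_self hδ⟩
      ⟨by rwa [Metric.mem_ball'], by rwa [Metric.mem_ball']⟩
    linarith)
  refine ⟨h, fun x => ⟨Metric.ball x (δ / 2), Metric.ball_mem_nhds x (half_pos hδ), ?_⟩⟩
  refine ((hG x).mono (Metric.ball_subset_ball (by linarith))).congr (d := h x - G x x)
    fun y hy => ?_
  have := hh x y (by rwa [← Metric.mem_ball'])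
  linarith

/-! ### Maps that are locally in a coordinate plane or on the circle -/

variable (S) in
/-- The map `p` is, on the set `N`, contained in a coordinate plane, or factors through the circle. -/
def LocalModel {X : Type*} [TopologicalSpace X] (p : X → Fin 3 → ℝ) (N : Set X) : Prop :=
  (∃ i, ∀ y ∈ N, p y i = 0) ∨
    ∃ u : X → ℝ, ContinuousOn u N ∧ ∀ y ∈ N, p y = S.toFun (u y)

theorem LocalModel.comp {X Y : Type*} [TopologicalSpace X] [TopologicalSpace Y] {p : X → Fin 3 → ℝ}
    {N : Set X} (h : S.LocalModel p N) {f : Y → X} {M : Set Y} (hf : ContinuousOn f M)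
    (hfM : Set.MapsTo f M N) : S.LocalModel (p ∘ f) M := by
  rcases h with ⟨i, hi⟩ | ⟨u, hu, hp⟩
  · exact Or.inl ⟨i, fun y hy => hi _ (hfM hy)⟩
  · exact Or.inr ⟨u ∘ f, hu.comp hf hfM, fun y hy => hp _ (hfM hy)⟩

theorem LocalModel.congr {X : Type*} [TopologicalSpace X] {p q : X → Fin 3 → ℝ}
    {N : Set X} (h : S.LocalModel p N) (hq : ∀ y ∈ N, q y = p y) : S.LocalModel q N := by
  rcases h with ⟨i, hi⟩ | ⟨u, hu, hp⟩
  · exact Or.inl ⟨i, fun y hy => by rw [hq y hy, hi y hy]⟩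
  · exact Or.inr ⟨u, hu, fun y hy => by rw [hq y hy, hp y hy]⟩

theorem LocalModel.exists_localPrimitive {X : Type*} [TopologicalSpace X] {p : X → Fin 3 → ℝ}
    {N : Set X} (h : S.LocalModel p N) {x : X} (hN : N ∈ 𝓝 x) :
    ∃ M ∈ 𝓝 x, ∃ g, S.LocalPrimitive p M g := by
  rcases h with ⟨i, hi⟩ | ⟨u, hu, hp⟩
  · exact ⟨N, hN, fun _ => 0, Or.inl ⟨⟨i, hi⟩, 0, fun _ _ => rfl⟩⟩
  · let n : ℤ := ⌊(u x + 1) / 6⌋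
    have hn0 : -2 < u x - n * 6 := by linarith [Int.floor_le ((u x + 1) / 6)]
    have hn1 : u x - n * 6 < 6 := by linarith [Int.lt_floor_add_one ((u x + 1) / 6)]
    have hu' : ContinuousOn (fun y => u y - n * 6) N := hu.sub continuousOn_const
    refine ⟨N ∩ {y | u y - n * 6 ∈ Set.Ioo (-2) 6}, inter_mem hN
      ((hu'.continuousAt hN).preimage_mem_nhds (Ioo_mem_nhds hn0 hn1)),
      fun y => cantorFun (u y - n * 6), Or.inr ⟨fun y => u y - n * 6,
        hu'.mono Set.inter_subset_left, fun y hy => ⟨hy.2, ?_⟩, 0, fun y _ => by rw [add_zero]⟩⟩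
    rw [S.toFun_sub_int, hp y hy.1]

variable (S) in
/-- The diffeology on a set over the union of the coordinate planes whose plots are the maps that
are locally in a coordinate plane or on the circle. -/
abbrev modelDiffeology {A : Type} (V : A → Fin 3 → ℝ) (hV : ∀ a, ∃ i, V a i = 0) :
    DiffeologicalSpace A where
  plots n := {p | ∀ x, ∃ N ∈ 𝓝 x, S.LocalModel (V ∘ p) N}
  constant_plots a _ := ⟨Set.univ, univ_mem, Or.inl
    ⟨(hV a).choose, fun _ _ => (hV a).choose_spec⟩⟩
  plot_reparam {n m p f} hp hf x := by
    obtain ⟨N, hN, h⟩ := hp (f x)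
    exact ⟨f ⁻¹' N, hf.continuous.continuousAt.preimage_mem_nhds hN,
      h.comp hf.continuous.continuousOn (Set.mapsTo_preimage _ _)⟩
  locality {n p} hp x := by
    obtain ⟨u, hu, hxu, h⟩ := hp x
    obtain ⟨ε, hε, hεu⟩ := Metric.isOpen_iff.1 hu x hxu
    -- Locality provides only reparametrizations defined on a full Euclidean space, so the ball is
    -- parametrized by the whole space and the model carried back by the inverse.
    let e := OpenPartialHomeomorph.univBall x ε
    have het : e.target = Metric.ball x ε := OpenPartialHomeomorph.univBall_target x hε
    have hes : e.source = Set.univ := OpenPartialHomeomorph.univBall_source x ε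
    obtain ⟨N, hN, hm⟩ := h (f := e) (fun y => hεu (het ▸ e.map_source (hes ▸ Set.mem_univ y)))
      OpenPartialHomeomorph.contDiff_univBall (e.symm x)
    have hxt : x ∈ e.target := het ▸ Metric.mem_ball_self hε
    have hcont : ContinuousOn e.symm e.target := e.continuousOn_symm
    refine ⟨e.target ∩ e.symm ⁻¹' N, inter_mem (e.open_target.mem_nhds hxt)
      ((hcont.continuousAt (e.open_target.mem_nhds hxt)).preimage_mem_nhds hN), ?_⟩
    refine (hm.comp (hcont.mono Set.inter_subset_left) fun y hy => hy.2).congr fun y hy => ?_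
    exact congrArg (fun z => V (p z)) (e.right_inv hy.1).symm

end OscillatingCircle

/-! ### Coordinates on the realization of the 3-simplex -/

theorem ExtSimplex.map_coord_eq_zero {m n : SimplexCategory} (f : m ⟶ n) (y : ExtSimplex m)
    {j : Fin (n.len + 1)} (h : ∀ k, f.toOrderHom k ≠ j) : (ExtSimplex.map f y).coord j = 0 := by
  simp only [ExtSimplex.map]
  exact Finset.sum_eq_zero fun k hk => absurd (Finset.mem_filter.1 hk).2 (h k)

theorem ExtSimplex.map_coord_of_injective {m n : SimplexCategory} (f : m ⟶ n) (y : ExtSimplex m)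
    (hf : Function.Injective f.toOrderHom) (k : Fin (m.len + 1)) :
    (ExtSimplex.map f y).coord (f.toOrderHom k) = y.coord k := by
  simp only [ExtSimplex.map]
  exact Finset.sum_eq_single k (fun _ hl hlk => absurd (hf (Finset.mem_filter.1 hl).2) hlk)
    fun hk => absurd (by simp) hk

/-- The map from a simplex to the smooth singular complex of the extended smooth simplex. -/
noncomputable def stdSimplexToSmSing (n : ℕ) :
    (Δ[n] : SSet.{0}) ⟶ SmSing.obj (extSimplexFunctor.obj ⦋n⦌) where
  app m := TypeCat.ofHom fun x => extSimplexFunctor.map (SSet.stdSimplex.objEquiv x)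
  naturality _ _ f := by
    ext x
    exact extSimplexFunctor.map_comp f.unop (SSet.stdSimplex.objEquiv x)

/-- The barycentric coordinates of a point of `|Δ³|`. -/
noncomputable def baryMap : smReal.obj (Δ[3] : SSet.{0}) ⟶ extSimplexFunctor.obj ⦋3⦌ :=
  SmReal.desc (stdSimplexToSmSing 3)

theorem pt_eq_pt_id {m : SimplexCategory} (x : (Δ[3] : SSet.{0}).obj (op m)) (y : ExtSimplex m) :
    SmReal.pt x y = SmReal.pt (n := ⦋3⦌) (SSet.stdSimplex.objEquiv.symm (𝟙 ⦋3⦌))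
      (ExtSimplex.map (SSet.stdSimplex.objEquiv x) y) := by
  rw [← SmReal.pt_map]
  congr 1
  apply SSet.stdSimplex.objEquiv.injective
  exact (Category.comp_id _).symm

/-- The inverse of `chart`. -/
noncomputable def chartCoord (y : smReal.obj (Δ[3] : SSet.{0})) : Fin 3 → ℝ :=
  fun j => (show ExtSimplex ⦋3⦌ from baryMap.toFun y).coord j.succ

theorem chartCoord_chart (v : Fin 3 → ℝ) : chartCoord (chart v) = v := by
  funext j
  change (ExtSimplex.map (𝟙 ⦋3⦌) _).coord j.succ = _
  rw [ExtSimplex.map_id]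
  rfl

theorem chart_chartCoord (y : smReal.obj (Δ[3] : SSet.{0})) : chart (chartCoord y) = y := by
  obtain ⟨⟨m, x, y⟩⟩ := y
  refine Eq.trans ?_ (pt_eq_pt_id x y).symm
  refine congrArg (SmReal.pt _) (ExtSimplex.ext (funext fun j => ?_))
  refine Fin.cases ?_ (fun i => rfl) j
  have := (ExtSimplex.map (SSet.stdSimplex.objEquiv x) y).sum_coord
  rw [Fin.sum_univ_succ] at this
  exact (eq_sub_of_add_eq this).symm

/-- The points of a simplex of the horn are in one of the coordinate planes. -/
theorem exists_chartCoord_smoothHorn_pt {m : SimplexCategory}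
    (x : (Λ[3, 0] : SSet.{0}).obj (op m)) :
    ∃ i, ∀ y : ExtSimplex m, chartCoord (smoothHorn.toFun (SmReal.pt x y)) i = 0 := by
  have hx := x.2
  rw [SSet.mem_horn_iff, Set.ne_univ_iff_exists_notMem] at hx
  obtain ⟨j, hj⟩ := hx
  rw [Set.mem_union, not_or] at hj
  obtain ⟨i, rfl⟩ := Fin.exists_succ_eq.2 hj.2
  exact ⟨i, fun y => ExtSimplex.map_coord_eq_zero _ y fun k hk => hj.1 ⟨k, hk⟩⟩

theorem exists_chartCoord_smoothHorn (y : smReal.obj (Λ[3, 0] : SSet.{0})) :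
    ∃ i, chartCoord (smoothHorn.toFun y) i = 0 := by
  obtain ⟨⟨m, x, y⟩⟩ := y
  obtain ⟨i, hi⟩ := exists_chartCoord_smoothHorn_pt x
  exact ⟨i, hi y⟩

/-- The points of the coordinate planes are in the image of the horn. -/
theorem exists_smoothHorn_eq {z : smReal.obj (Δ[3] : SSet.{0})} {i : Fin 3}
    (hz : chartCoord z i = 0) : ∃ y, smoothHorn.toFun y = z := by
  let e : ExtSimplex ⦋3⦌ := baryMap.toFun z
  have he : e.coord i.succ = 0 := hz
  let e' : ExtSimplex ⦋2⦌ :=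
    ⟨fun k => e.coord (i.succ.succAbove k), by
      have := e.sum_coord
      rw [Fin.sum_univ_succAbove _ i.succ, he, zero_add] at this
      exact this⟩
  have hx : SSet.stdSimplex.objEquiv.symm (SimplexCategory.δ i.succ) ∈
      (Λ[3, 0] : (Δ[3] : SSet.{0}).Subcomplex).obj (op ⦋2⦌) := by
    rw [SSet.mem_horn_iff, Set.ne_univ_iff_exists_notMem]
    refine ⟨i.succ, ?_⟩
    rw [SSet.stdSimplex.coe_asOrderHom_objEquiv_symm, SimplexCategory.coe_δ,
      Fin.range_succAbove]
    simp [Fin.succ_ne_zero]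
  refine ⟨SmReal.pt (X := (Λ[3, 0] : SSet.{0})) ⟨_, hx⟩ e', ?_⟩
  refine (pt_eq_pt_id _ e').trans (Eq.trans ?_ (chart_chartCoord z))
  have hee : ExtSimplex.map (SimplexCategory.δ i.succ) e' = e := by
    ext j
    rcases Fin.eq_self_or_eq_succAbove i.succ j with rfl | ⟨k, rfl⟩
    · rw [he]
      exact ExtSimplex.map_coord_eq_zero _ _ fun k => Fin.succAbove_ne _ _
    · exact ExtSimplex.map_coord_of_injective (SimplexCategory.δ i.succ) e'
        Fin.succAbove_right_injective k
  change SmReal.pt _ (ExtSimplex.map (SimplexCategory.δ i.succ) e') = _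
  rw [hee]
  refine congrArg (SmReal.pt _) (ExtSimplex.ext (funext fun j => ?_))
  refine Fin.cases ?_ (fun i => rfl) j
  have := e.sum_coord
  rw [Fin.sum_univ_succ] at this
  exact eq_sub_of_add_eq this

/-! ### The Kan complex of real cocycles -/

/-- The classifying complex of the additive group of real numbers: its `n`-simplices are the
real-valued 1-cocycles on the set of vertices of the `n`-simplex. -/
def cocycleComplex : SSet.{0} where
  obj n := {c : Fin (n.unop.len + 1) → Fin (n.unop.len + 1) → ℝ //
    ∀ i j k, c i j + c j k = c i k}
  map f := TypeCat.ofHom fun c => ⟨fun i j => c.1 (f.unop.toOrderHom i) (f.unop.toOrderHom j),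
    fun _ _ _ => c.2 _ _ _⟩

namespace cocycleComplex

/-- The value of a cocycle on a pair of vertices. -/
def val {n : SimplexCategoryᵒᵖ} (c : cocycleComplex.obj n) (i j : Fin (n.unop.len + 1)) : ℝ :=
  c.1 i j

theorem val_add {n : SimplexCategoryᵒᵖ} (c : cocycleComplex.obj n)
    (i j k : Fin (n.unop.len + 1)) : val c i j + val c j k = val c i k := c.2 i j k

theorem val_self {n : SimplexCategoryᵒᵖ} (c : cocycleComplex.obj n) (i : Fin (n.unop.len + 1)) :
    val c i i = 0 := by
  have := val_add c i i i
  linarith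

theorem val_swap {n : SimplexCategoryᵒᵖ} (c : cocycleComplex.obj n)
    (i j : Fin (n.unop.len + 1)) : val c i j = -val c j i := by
  have := val_add c i j i
  rw [val_self] at this
  linarith

theorem val_app_map {X : SSet.{0}} (h : X ⟶ cocycleComplex) {m n : SimplexCategory} (f : m ⟶ n)
    (x : X.obj (op n)) (i j : Fin (m.len + 1)) :
    val (h.app (op m) (X.map f.op x)) i j =
      val (h.app (op n) x) (f.toOrderHom i) (f.toOrderHom j) := by
  have := ConcreteCategory.congr_hom (h.naturality f.op) x
  exact congrArg (fun c => val c i j) this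

theorem ext_val {n : SimplexCategoryᵒᵖ} {c c' : cocycleComplex.obj n}
    (h : ∀ i j, val c i j = val c' i j) : c = c' :=
  Subtype.ext (funext fun i => funext fun j => h i j)

/-- The vertices of a simplex of a standard simplex. -/
def vertex {n : ℕ} {m : SimplexCategory} (x : (Δ[n] : SSet.{0}).obj (op m)) :
    Fin (m.len + 1) →o Fin (n + 1) :=
  (SSet.stdSimplex.objEquiv x).toOrderHom

/-- The value of a map from a subcomplex of a simplex to the complex of cocycles on a pair of
vertices of a simplex depends only on these vertices. -/
theorem val_eq_of_vertex_eq {n : ℕ} {A : (Δ[n] : SSet.{0}).Subcomplex}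
    (t : (A : SSet.{0}) ⟶ cocycleComplex) {m m' : SimplexCategory}
    (x : (A : SSet.{0}).obj (op m)) (x' : (A : SSet.{0}).obj (op m'))
    {a b : Fin (m.len + 1)} {a' b' : Fin (m'.len + 1)} (ha : vertex x.1 a = vertex x'.1 a')
    (hb : vertex x.1 b = vertex x'.1 b') :
    val (t.app (op m) x) a b = val (t.app (op m') x') a' b' := by
  -- For ordered pairs both values are read off from the same edge of `A`.
  have key : ∀ a b a' b', a ≤ b → a' ≤ b' → vertex x.1 a = vertex x'.1 a' →
      vertex x.1 b = vertex x'.1 b' →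
      val (t.app (op m) x) a b = val (t.app (op m') x') a' b' := by
    intro a b a' b' hab hab' ha hb
    let f : ⦋1⦌ ⟶ m := SimplexCategory.mkOfLe a b hab
    let f' : ⦋1⦌ ⟶ m' := SimplexCategory.mkOfLe a' b' hab'
    have hx : (A : SSet.{0}).map f.op x = (A : SSet.{0}).map f'.op x' := by
      apply Subtype.ext
      apply SSet.stdSimplex.objEquiv.injective
      apply SimplexCategory.Hom.ext
      ext k
      fin_cases k
      · exact congrArg Fin.val ha
      · exact congrArg Fin.val hb
    exact (val_app_map t f x 0 1).symm.trans
      ((congrArg (fun z => val (t.app (op ⦋1⦌) z) 0 1) hx).trans (val_app_map t f' x' 0 1))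
  have hself : vertex x.1 a = vertex x.1 b →
      val (t.app (op m) x) a b = val (t.app (op m') x') a' b' := by
    intro h
    have h1 : val (t.app (op m) x) a b = 0 := by
      rcases le_total a b with hab | hab
      · exact (key a b a' a' hab le_rfl ha (h.symm.trans ha)).trans (val_self _ _)
      · rw [val_swap, key b a b' b' hab le_rfl hb (h.trans hb), val_self, neg_zero]
    have h2 : val (t.app (op m') x') a' b' = 0 := by
      rcases le_total a' b' with hab | hab
      · exact (key a a a' b' le_rfl hab ha (h.trans hb)).symm.trans (val_self _ _)
      · rw [val_swap, ← key b b b' a' le_rfl hab hb (h.symm.trans ha), val_self, neg_zero]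
    rw [h1, h2]
  -- Distinct vertices force the order of `a`, `b` and of `a'`, `b'` in the same way; reversed pairs
  -- are handled by antisymmetry.
  rcases lt_trichotomy (vertex x.1 a) (vertex x.1 b) with h | h | h
  · have h' := h
    rw [ha, hb] at h'
    exact key a b a' b' (le_of_not_ge fun hle => absurd h (not_lt.2 ((vertex x.1).monotone hle)))
      (le_of_not_ge fun hle => absurd h' (not_lt.2 ((vertex x'.1).monotone hle))) ha hb
  · exact hself h
  · have h' := h
    rw [ha, hb] at h'
    rw [val_swap, val_swap (t.app (op m') x'), key b a b' a'
      (le_of_not_ge fun hle => absurd h (not_lt.2 ((vertex x.1).monotone hle)))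
      (le_of_not_ge fun hle => absurd h' (not_lt.2 ((vertex x'.1).monotone hle))) hb ha]

/-- A function on the vertices of a simplex defines a map to the complex of cocycles. -/
def ofVertices {n : ℕ} (E : Fin (n + 1) → ℝ) : (Δ[n] : SSet.{0}) ⟶ cocycleComplex where
  app m := TypeCat.ofHom fun x => ⟨fun a b => E (vertex x b) - E (vertex x a),
    fun _ _ _ => by ring⟩

theorem δ_mem_horn {n : ℕ} {i l : Fin (n + 2)} (h : l ≠ i) :
    SSet.stdSimplex.objEquiv.symm (SimplexCategory.δ l) ∈
      (Λ[n + 1, i] : (Δ[n + 1] : SSet.{0}).Subcomplex).obj (op ⦋n⦌) := by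
  rw [SSet.mem_horn_iff, Set.ne_univ_iff_exists_notMem]
  refine ⟨l, ?_⟩
  rw [SSet.stdSimplex.coe_asOrderHom_objEquiv_symm, SimplexCategory.coe_δ, Fin.range_succAbove]
  simpa using h

/-- A cocycle on a simplex is the coboundary of its values on the edges out of one vertex. Every
simplex of the horn lies in a face containing the vertex `i`, so the values from `i` determine the
map. -/
theorem exists_horn_filler {n : ℕ} {i : Fin (n + 2)}
    (t : (Λ[n + 1, i] : SSet.{0}) ⟶ cocycleComplex) :
    ∃ φ : (Δ[n + 1] : SSet.{0}) ⟶ cocycleComplex, Λ[n + 1, i].ι ≫ φ = t := by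
  let R : Fin (n + 2) → ℝ → Prop := fun j r =>
    ∃ (m : SimplexCategory) (x : (Λ[n + 1, i] : SSet.{0}).obj (op m)) (a b : Fin (m.len + 1)),
      vertex x.1 a = i ∧ vertex x.1 b = j ∧ val (t.app (op m) x) a b = r
  have hR : ∀ j r r', R j r → R j r' → r = r' := by
    rintro j _ _ ⟨m, x, a, b, ha, hb, rfl⟩ ⟨m', x', a', b', ha', hb', rfl⟩
    exact val_eq_of_vertex_eq t x x' (ha.trans ha'.symm) (hb.trans hb'.symm)
  have hE : ∃ E : Fin (n + 2) → ℝ, ∀ j r, R j r → E j = r := by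
    classical
    -- The default 0 serves a vertex not joined to `i` in the horn, as in dimension 1, where the
    -- edge may be filled arbitrarily.
    refine ⟨fun j => if h : ∃ r, R j r then h.choose else 0, fun j r h => ?_⟩
    have h' : ∃ r, R j r := ⟨r, h⟩
    exact (dif_pos h').trans (hR j _ _ h'.choose_spec h)
  obtain ⟨E, hE⟩ := hE
  refine ⟨ofVertices E, ?_⟩
  ext ⟨m⟩ x
  refine ext_val fun a b => ?_
  have hx := x.2
  rw [SSet.mem_horn_iff, Set.ne_univ_iff_exists_notMem] at hx
  obtain ⟨l, hl⟩ := hx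
  rw [Set.mem_union, not_or] at hl
  have hli : l ≠ i := hl.2
  let y : (Λ[n + 1, i] : SSet.{0}).obj (op ⦋n⦌) := ⟨_, δ_mem_horn hli⟩
  have hy : ∀ k, vertex y.1 k = l.succAbove k := fun k => rfl
  obtain ⟨i', hi'⟩ := Fin.exists_succAbove_eq hli.symm
  obtain ⟨a', ha'⟩ := Fin.exists_succAbove_eq (x := vertex x.1 a) (y := l) fun h => hl.1 ⟨a, h⟩
  obtain ⟨b', hb'⟩ := Fin.exists_succAbove_eq (x := vertex x.1 b) (y := l) fun h => hl.1 ⟨b, h⟩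
  have h1 : val (t.app (op m) x) a b = val (t.app (op ⦋n⦌) y) a' b' :=
    val_eq_of_vertex_eq t x y ((hy a').trans ha').symm ((hy b').trans hb').symm
  have h2 : E (vertex x.1 a) = val (t.app (op ⦋n⦌) y) i' a' :=
    hE _ _ ⟨_, y, i', a', hi', ha', rfl⟩
  have h3 : E (vertex x.1 b) = val (t.app (op ⦋n⦌) y) i' b' :=
    hE _ _ ⟨_, y, i', b', hi', hb', rfl⟩
  have h4 := val_add (t.app (op ⦋n⦌) y) i' a' b'
  change E (vertex x.1 b) - E (vertex x.1 a) = val (t.app (op m) x) a b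
  rw [h1, h2, h3]
  linarith

open Limits in
instance : SSet.KanComplex cocycleComplex := by
  refine (isFibrant_iff _).2 ⟨?_⟩
  rw [SSet.modelCategoryQuillen.fibrations_eq]
  intro _ _ _ hf
  simp only [SSet.modelCategoryQuillen.J, MorphismProperty.iSup_iff] at hf
  obtain ⟨n, ⟨i⟩⟩ := hf
  refine ⟨fun {t _} _ => ?_⟩
  obtain ⟨φ, hφ⟩ := exists_horn_filler t
  exact ⟨⟨{
    l := φ
    fac_left := hφ
    fac_right := by subsingleton }⟩⟩

/-- Homotopic maps to the complex of cocycles agree on loops. -/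
theorem val_eq_of_homotopy {X : SSet.{0}} {f g : X ⟶ cocycleComplex} (H : SSet.Homotopy f g)
    {γ : X.obj (op ⦋1⦌)} (hγ : X.δ 0 γ = X.δ 1 γ) :
    val (f.app (op ⦋1⦌) γ) 0 1 = val (g.app (op ⦋1⦌) γ) 0 1 := by
  obtain ⟨H'⟩ : Nonempty (SimplicialObject.Homotopy f g) := ⟨H.toSimplicialObjectHomotopy⟩
  -- `A` and `B` are the two triangles of the square swept out by `γ`. They share the diagonal
  -- (`e3`), and their vertical sides agree because the ends of `γ` do (`e4`, `e5`, `hγ`).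
  let A : cocycleComplex.obj (op ⦋2⦌) := H'.h (n := 1) 0 γ
  let B : cocycleComplex.obj (op ⦋2⦌) := H'.h (n := 1) 1 γ
  have e1 : cocycleComplex.δ 0 A = g.app (op ⦋1⦌) γ :=
    ConcreteCategory.congr_hom (H'.h_zero_comp_δ_zero 1) γ
  have e2 : cocycleComplex.δ 2 B = f.app (op ⦋1⦌) γ :=
    ConcreteCategory.congr_hom (H'.h_last_comp_δ_last 1) γ
  have e3 : cocycleComplex.δ 1 B = cocycleComplex.δ 1 A :=
    ConcreteCategory.congr_hom (H'.h_succ_comp_δ_castSucc_succ (n := 0) 0) γ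
  have e4 : cocycleComplex.δ 0 B = H'.h (n := 0) 0 (X.δ 0 γ) :=
    ConcreteCategory.congr_hom (H'.h_succ_comp_δ_castSucc_of_lt (n := 0) 0 0 le_rfl) γ
  have e5 : cocycleComplex.δ 2 A = H'.h (n := 0) 0 (X.δ 1 γ) :=
    ConcreteCategory.congr_hom (H'.h_castSucc_comp_δ_succ_of_lt (n := 0) 1 0 (by decide)) γ
  have a1 : val A 1 2 = val (g.app (op ⦋1⦌) γ) 0 1 := by rw [← e1]; rfl
  have a2 : val B 0 1 = val (f.app (op ⦋1⦌) γ) 0 1 := by rw [← e2]; rfl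
  have a3 : val B 0 2 = val A 0 2 := congrArg (fun c => val c 0 1) e3
  have a4 : val B 1 2 = val A 0 1 :=
    congrArg (fun c => val c 0 1) (e4.trans ((congrArg (fun z => H'.h (n := 0) 0 z) hγ).trans
      e5.symm))
  have s1 := val_add A 0 1 2
  have s2 := val_add B 0 1 2
  linarith

end cocycleComplex

/-! ### Loops in the smooth singular complex of the 3-simplex -/

theorem chartCoord_contDiff {n : ℕ} {p : EuclideanSpace ℝ (Fin n) → smReal.obj (Δ[3] : SSet.{0})}
    (hp : Diffeology.IsPlot p) : ContDiff ℝ ∞ fun u => chartCoord (p u) :=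
  contDiff_pi.2 fun j => contDiff_pi.1 (ExtSimplex.isPlot_iff.1 (baryMap.smooth n p hp)) j.succ

namespace ExtSimplex

/-- The parametrization of the extended 1-simplex by the real line. -/
def line (t : ℝ) : ExtSimplex ⦋1⦌ where
  coord := Fin.cons (1 - t) fun _ => t
  sum_coord := by simp [Fin.sum_univ_succ]

theorem coord_add (y : ExtSimplex ⦋1⦌) : y.coord 0 + y.coord 1 = 1 :=
  (Fin.sum_univ_two _).symm.trans y.sum_coord

theorem line_coord (y : ExtSimplex ⦋1⦌) : line (y.coord 1) = y := by
  ext j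
  refine Fin.cases ?_ (fun k => ?_) j
  · exact (eq_sub_of_add_eq (coord_add y)).symm
  · rw [Subsingleton.elim k 0]
    rfl

theorem coord_contDiff {m : SimplexCategory} {n : ℕ} {p : EuclideanSpace ℝ (Fin n) → ExtSimplex m}
    (hp : Diffeology.IsPlot p) (j : Fin (m.len + 1)) : ContDiff ℝ ∞ fun u => (p u).coord j :=
  contDiff_pi.1 (isPlot_iff.1 hp) j

theorem coord_zero_of_zero (y : ExtSimplex ⦋0⦌) : y.coord 0 = 1 := by
  have := y.sum_coord
  simpa using this

/-- The point of the extended 0-simplex. -/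
def point : ExtSimplex ⦋0⦌ where
  coord _ := 1
  sum_coord := by simp

theorem map_δ_coord_succAbove {n : ℕ} (i : Fin (n + 2)) (y : ExtSimplex ⦋n⦌) (k : Fin (n + 1)) :
    (map (SimplexCategory.δ i) y).coord (i.succAbove k) = y.coord k :=
  map_coord_of_injective (SimplexCategory.δ i) y Fin.succAbove_right_injective k

theorem map_δ_coord_self {n : ℕ} (i : Fin (n + 2)) (y : ExtSimplex ⦋n⦌) :
    (map (SimplexCategory.δ i) y).coord i = 0 :=
  map_coord_eq_zero _ _ fun k => Fin.succAbove_ne i k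

theorem map_δ_zero_coord_one (y : ExtSimplex ⦋0⦌) : (map (SimplexCategory.δ 0) y).coord 1 = 1 :=
  (map_δ_coord_succAbove 0 y 0).trans (coord_zero_of_zero y)

theorem map_δ_one_coord_one (y : ExtSimplex ⦋0⦌) : (map (SimplexCategory.δ 1) y).coord 1 = 0 :=
  map_δ_coord_self 1 y

end ExtSimplex

/-- A simplex of the smooth singular complex of `|Δ³|`, given in coordinates. -/
noncomputable def chartSimplex {m : SimplexCategory} (q : ExtSimplex m → Fin 3 → ℝ)
    (hq : ∀ (n : ℕ) (p : EuclideanSpace ℝ (Fin n) → ExtSimplex m), Diffeology.IsPlot p →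
      ContDiff ℝ ∞ fun u => q (p u)) : (SmSing.obj (smReal.obj (Δ[3] : SSet.{0}))).obj (op m) :=
  Diffeo.Hom.mk (X := extSimplexFunctor.obj m) (Y := smReal.obj (Δ[3] : SSet.{0}))
    (fun x => chart (q x)) fun n p hp => chart_isPlot (hq n p hp)

namespace cocycleComplex

/-- A constant edge is degenerate, so its value is that of a vertex paired with itself. -/
theorem val_const (h : SmSing.obj (smReal.obj (Δ[3] : SSet.{0})) ⟶ cocycleComplex)
    {x : (SmSing.obj (smReal.obj (Δ[3] : SSet.{0}))).obj (op ⦋1⦌)} (v : Fin 3 → ℝ)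
    (hx : ∀ y, (SmReal.simplexHom x).toFun y = chart v) : val (h.app (op ⦋1⦌) x) 0 1 = 0 := by
  let x₀ : (SmSing.obj (smReal.obj (Δ[3] : SSet.{0}))).obj (op ⦋0⦌) :=
    chartSimplex (fun _ => v) fun _ _ _ => contDiff_const
  have e : x = (SmSing.obj (smReal.obj (Δ[3] : SSet.{0}))).map (SimplexCategory.σ 0).op x₀ :=
    Diffeo.hom_ext hx
  have := val_app_map h (SimplexCategory.σ (0 : Fin 1)) x₀ 0 1
  rw [e]
  exact this.trans ((congrArg (val (h.app (op ⦋0⦌) x₀) _) (Subsingleton.elim (α := Fin 1) _ _)).trans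
    (val_self _ _))

/-- The contraction (s, t) ↦ g(0) + s(g(t) - g(0)) of the square is cut along s = t into `σ₁` (s ≥
t) and `σ₂` (t ≥ s). One side of the square is `γ` and the other three are constant, so the cocycle
relations on the two triangles give 0. -/
theorem val_loop_eq_zero (h : SmSing.obj (smReal.obj (Δ[3] : SSet.{0})) ⟶ cocycleComplex)
    {γ : (SmSing.obj (smReal.obj (Δ[3] : SSet.{0}))).obj (op ⦋1⦌)}
    (hγ : (SmSing.obj (smReal.obj (Δ[3] : SSet.{0}))).δ 0 γ =
      (SmSing.obj (smReal.obj (Δ[3] : SSet.{0}))).δ 1 γ) :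
    val (h.app (op ⦋1⦌) γ) 0 1 = 0 := by
  let g : ℝ → Fin 3 → ℝ := fun t => chartCoord ((SmReal.simplexHom γ).toFun (ExtSimplex.line t))
  have hg : ContDiff ℝ ∞ g := by
    have hl : Diffeology.IsPlot fun u : EuclideanSpace ℝ (Fin 1) => ExtSimplex.line (u 0) := by
      have h0 : ContDiff ℝ ∞ fun u : EuclideanSpace ℝ (Fin 1) => u 0 :=
        contDiff_euclidean.1 contDiff_id 0
      refine ExtSimplex.isPlot_iff.2 (contDiff_pi.2 fun j => ?_)
      exact Fin.cases (contDiff_const.sub h0) (fun _ => h0) j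
    have h1 := chartCoord_contDiff ((SmReal.simplexHom γ).smooth _ _ hl)
    have h2 : ContDiff ℝ ∞ fun t : ℝ => (WithLp.toLp 2 fun _ => t : EuclideanSpace ℝ (Fin 1)) :=
      contDiff_euclidean.2 fun _ => contDiff_id
    exact h1.comp h2
  have hγg : ∀ y : ExtSimplex ⦋1⦌, (SmReal.simplexHom γ).toFun y = chart (g (y.coord 1)) := by
    intro y
    simp only [g]
    rw [chart_chartCoord, ExtSimplex.line_coord]
  have hg01 : g 1 = g 0 := by
    have := congrArg (fun z => chartCoord ((SmReal.simplexHom z).toFun ExtSimplex.point)) hγ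
    have e0 : chartCoord ((SmReal.simplexHom γ).toFun
        (ExtSimplex.map (SimplexCategory.δ 0) ExtSimplex.point)) = g 1 := by
      rw [hγg, chartCoord_chart, ExtSimplex.map_δ_zero_coord_one]
    have e1 : chartCoord ((SmReal.simplexHom γ).toFun
        (ExtSimplex.map (SimplexCategory.δ 1) ExtSimplex.point)) = g 0 := by
      rw [hγg, chartCoord_chart, ExtSimplex.map_δ_one_coord_one]
    rw [← e0, ← e1]
    exact this
  have hsm : ∀ (a b : ExtSimplex ⦋2⦌ → ℝ),
      (∀ (n : ℕ) (p : EuclideanSpace ℝ (Fin n) → ExtSimplex ⦋2⦌), Diffeology.IsPlot p →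
        ContDiff ℝ ∞ fun u => a (p u)) →
      (∀ (n : ℕ) (p : EuclideanSpace ℝ (Fin n) → ExtSimplex ⦋2⦌), Diffeology.IsPlot p →
        ContDiff ℝ ∞ fun u => b (p u)) →
      ∀ (n : ℕ) (p : EuclideanSpace ℝ (Fin n) → ExtSimplex ⦋2⦌), Diffeology.IsPlot p →
        ContDiff ℝ ∞ fun u => g 0 + a (p u) • (g (b (p u)) - g 0) := fun a b ha hb n p hp =>
    contDiff_const.add ((ha n p hp).smul ((hg.comp (hb n p hp)).sub contDiff_const))
  let Y := SmSing.obj (smReal.obj (Δ[3] : SSet.{0}))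
  let σ₁ : Y.obj (op ⦋2⦌) :=
    chartSimplex (fun x => g 0 + (x.coord 1 + x.coord 2) • (g (x.coord 2) - g 0))
      (hsm (fun x => x.coord 1 + x.coord 2) (fun x => x.coord 2)
        (fun n p hp => (ExtSimplex.coord_contDiff hp 1).add (ExtSimplex.coord_contDiff hp 2))
        fun n p hp => ExtSimplex.coord_contDiff hp 2)
  let σ₂ : Y.obj (op ⦋2⦌) :=
    chartSimplex (fun x => g 0 + x.coord 2 • (g (x.coord 1 + x.coord 2) - g 0))
      (hsm (fun x => x.coord 2) (fun x => x.coord 1 + x.coord 2)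
        (fun n p hp => ExtSimplex.coord_contDiff hp 2)
        fun n p hp => (ExtSimplex.coord_contDiff hp 1).add (ExtSimplex.coord_contDiff hp 2))
  have d00 : ∀ y : ExtSimplex ⦋1⦌, (ExtSimplex.map (SimplexCategory.δ 0) y).coord 1 = y.coord 0 :=
    fun y => ExtSimplex.map_δ_coord_succAbove 0 y 0
  have d01 : ∀ y : ExtSimplex ⦋1⦌, (ExtSimplex.map (SimplexCategory.δ 0) y).coord 2 = y.coord 1 :=
    fun y => ExtSimplex.map_δ_coord_succAbove 0 y 1
  have d10 : ∀ y : ExtSimplex ⦋1⦌, (ExtSimplex.map (SimplexCategory.δ 1) y).coord 1 = 0 :=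
    fun y => ExtSimplex.map_δ_coord_self 1 y
  have d11 : ∀ y : ExtSimplex ⦋1⦌, (ExtSimplex.map (SimplexCategory.δ 1) y).coord 2 = y.coord 1 :=
    fun y => ExtSimplex.map_δ_coord_succAbove 1 y 1
  have d20 : ∀ y : ExtSimplex ⦋1⦌, (ExtSimplex.map (SimplexCategory.δ 2) y).coord 1 = y.coord 1 :=
    fun y => ExtSimplex.map_δ_coord_succAbove 2 y 1
  have d21 : ∀ y : ExtSimplex ⦋1⦌, (ExtSimplex.map (SimplexCategory.δ 2) y).coord 2 = 0 :=
    fun y => ExtSimplex.map_δ_coord_self 2 y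
  have a0 : Y.map (SimplexCategory.δ 0).op σ₁ = γ := Diffeo.hom_ext fun (y : ExtSimplex ⦋1⦌) => by
    let z := ExtSimplex.map (SimplexCategory.δ 0) y
    have q : g 0 + (z.coord 1 + z.coord 2) • (g (z.coord 2) - g 0) = g (y.coord 1) := by
      rw [d00, d01, ExtSimplex.coord_add, one_smul, add_sub_cancel]
    exact (congrArg chart q).trans (hγg y).symm
  have a1 : Y.map (SimplexCategory.δ 1).op σ₁ = Y.map (SimplexCategory.δ 1).op σ₂ :=
    Diffeo.hom_ext fun (y : ExtSimplex ⦋1⦌) => by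
      let z := ExtSimplex.map (SimplexCategory.δ 1) y
      have q : g 0 + (z.coord 1 + z.coord 2) • (g (z.coord 2) - g 0) =
          g 0 + z.coord 2 • (g (z.coord 1 + z.coord 2) - g 0) := by
        rw [d10, d11, zero_add]
      exact congrArg chart q
  have v1 := val_add (h.app (op ⦋2⦌) σ₁) 0 1 2
  have v2 := val_add (h.app (op ⦋2⦌) σ₂) 0 1 2
  have w1 : val (h.app (op ⦋2⦌) σ₁) 0 1 = 0 :=
    (val_app_map h (SimplexCategory.δ (2 : Fin 3)) σ₁ 0 1).symm.trans (val_const h (g 0) fun (y : ExtSimplex ⦋1⦌) => by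
      let z := ExtSimplex.map (SimplexCategory.δ 2) y
      have q : g 0 + (z.coord 1 + z.coord 2) • (g (z.coord 2) - g 0) = g 0 := by
        rw [d20, d21, sub_self, smul_zero, add_zero]
      exact congrArg chart q)
  have w2 : val (h.app (op ⦋2⦌) σ₂) 0 1 = 0 :=
    (val_app_map h (SimplexCategory.δ (2 : Fin 3)) σ₂ 0 1).symm.trans (val_const h (g 0) fun (y : ExtSimplex ⦋1⦌) => by
      let z := ExtSimplex.map (SimplexCategory.δ 2) y
      have q : g 0 + z.coord 2 • (g (z.coord 1 + z.coord 2) - g 0) = g 0 := by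
        rw [d21, zero_smul, add_zero]
      exact congrArg chart q)
  have w3 : val (h.app (op ⦋2⦌) σ₂) 1 2 = 0 :=
    (val_app_map h (SimplexCategory.δ (0 : Fin 3)) σ₂ 0 1).symm.trans (val_const h (g 0) fun (y : ExtSimplex ⦋1⦌) => by
      let z := ExtSimplex.map (SimplexCategory.δ 0) y
      have q : g 0 + z.coord 2 • (g (z.coord 1 + z.coord 2) - g 0) = g 0 := by
        rw [d00, d01, ExtSimplex.coord_add, hg01, sub_self, smul_zero, add_zero]
      exact congrArg chart q)
  have w4 : val (h.app (op ⦋2⦌) σ₁) 1 2 = val (h.app (op ⦋1⦌) γ) 0 1 :=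
    (val_app_map h (SimplexCategory.δ (0 : Fin 3)) σ₁ 0 1).symm.trans
      (congrArg (fun z => val (h.app (op ⦋1⦌) z) 0 1) a0)
  have w5 : val (h.app (op ⦋2⦌) σ₁) 0 2 = val (h.app (op ⦋2⦌) σ₂) 0 2 :=
    (val_app_map h (SimplexCategory.δ (1 : Fin 3)) σ₁ 0 1).symm.trans
      ((congrArg (fun z => val (h.app (op ⦋1⦌) z) 0 1) a1).trans
        (val_app_map h (SimplexCategory.δ (1 : Fin 3)) σ₂ 0 1))
  linarith

end cocycleComplex

/-! ### Affine coordinates on the extended simplices -/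

namespace ExtSimplex

/-- The parametrization of the extended `n`-simplex by `ℝⁿ`. -/
noncomputable def ofAffine {m : SimplexCategory} (u : EuclideanSpace ℝ (Fin m.len)) :
    ExtSimplex m where
  coord := Fin.cons (1 - ∑ i, u i) u
  sum_coord := by simp [Fin.sum_univ_succ]

/-- The affine coordinates of a point of the extended `n`-simplex. -/
noncomputable def toAffine {m : SimplexCategory} (y : ExtSimplex m) :
    EuclideanSpace ℝ (Fin m.len) :=
  WithLp.toLp 2 fun i => y.coord i.succ

theorem ofAffine_toAffine {m : SimplexCategory} (y : ExtSimplex m) : ofAffine (toAffine y) = y := by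
  ext j
  refine Fin.cases ?_ (fun i => rfl) j
  have := y.sum_coord
  rw [Fin.sum_univ_succ] at this
  exact (eq_sub_of_add_eq this).symm

theorem isPlot_ofAffine {m : SimplexCategory} : Diffeology.IsPlot (ofAffine (m := m)) := by
  have h := contDiff_euclidean.1 (contDiff_id (𝕜 := ℝ) (E := EuclideanSpace ℝ (Fin m.len)) (n := ∞))
  refine isPlot_iff.2 (contDiff_pi.2 fun j => ?_)
  refine Fin.cases ?_ (fun i => h i) j
  exact contDiff_const.sub (ContDiff.sum fun i _ => h i)

/-- The inclusion of the simplex in the extended simplex. -/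
def ofStdSimplex {m : SimplexCategory} (x : stdSimplex ℝ (Fin (m.len + 1))) : ExtSimplex m where
  coord := x.1
  sum_coord := x.2.2

theorem map_ofStdSimplex {m n : SimplexCategory} (f : m ⟶ n)
    (x : stdSimplex ℝ (Fin (m.len + 1))) :
    map f (ofStdSimplex x) = ofStdSimplex (stdSimplex.map f.toOrderHom x) := by
  ext j
  exact (FunOnFinite.linearMap_apply_apply ℝ ℝ f.toOrderHom x j).symm

theorem continuous_toAffine_ofStdSimplex {m : SimplexCategory} :
    Continuous fun x : stdSimplex ℝ (Fin (m.len + 1)) => toAffine (ofStdSimplex x) :=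
  (PiLp.continuous_toLp 2 _).comp
    (continuous_pi fun i => (continuous_apply i.succ).comp continuous_subtype_val)

end ExtSimplex

namespace OscillatingCircle

variable (S : OscillatingCircle)

/-! ### Plots of the space generated by a circle -/

theorem exists_chartCoord_FIncl (y : S.F) : ∃ i, chartCoord (S.FIncl.toFun y) i = 0 := by
  obtain ⟨y, q, hq, u, rfl⟩ := y
  change ∃ i, chartCoord (q.2 u) i = 0
  rcases hq with ⟨p, -, h⟩ | rfl
  · rw [h]
    exact exists_chartCoord_smoothHorn (p u)
  · rw [chartCoord_chart]
    exact S.exists_toFun_eq_zero _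

theorem exists_localModel_smoothHorn {n : ℕ}
    {p : EuclideanSpace ℝ (Fin n) → smReal.obj (Λ[3, 0] : SSet.{0})} (hp : Diffeology.IsPlot p) :
    ∀ x, ∃ N ∈ 𝓝 x, S.LocalModel (fun u => chartCoord (smoothHorn.toFun (p u))) N :=
  hp (S.modelDiffeology (fun y => chartCoord (smoothHorn.toFun y)) exists_chartCoord_smoothHorn) (by
    rintro ⟨k, q⟩ ⟨m, x, r, -, h⟩ v
    obtain ⟨i, hi⟩ := exists_chartCoord_smoothHorn_pt x
    refine ⟨Set.univ, univ_mem, Or.inl ⟨i, fun u _ => ?_⟩⟩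
    change q = _ at h
    rw [h]
    exact hi (r u))

/-- A plot of a generated diffeology belongs to every diffeology containing the generators, in
particular to `modelDiffeology`. -/
theorem exists_localModel_FIncl {n : ℕ} {p : EuclideanSpace ℝ (Fin n) → S.F}
    (hp : Diffeology.IsPlot p) :
    ∀ x, ∃ N ∈ 𝓝 x, S.LocalModel (fun u => chartCoord (S.FIncl.toFun (p u))) N :=
  hp (S.modelDiffeology (fun y => chartCoord (S.FIncl.toFun y)) S.exists_chartCoord_FIncl) (by
    rintro ⟨k, q⟩ (⟨p, hp, h⟩ | h) v
    · have h' : ∀ u, S.FIncl.toFun (q u) = smoothHorn.toFun (p u) := fun u => congrFun h u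
      obtain ⟨N, hN, hm⟩ := S.exists_localModel_smoothHorn hp v
      exact ⟨N, hN, hm.congr fun u _ => congrArg chartCoord (h' u)⟩
    · obtain ⟨rfl, h⟩ := Sigma.mk.inj h
      have h' : ∀ u, S.FIncl.toFun (q u) = chart (S.toFun (u 0)) :=
        fun u => congrFun (eq_of_heq h) u
      refine ⟨Set.univ, univ_mem, Or.inr ⟨fun u => u 0, ?_, fun u _ => ?_⟩⟩
      · exact (contDiff_euclidean.1 (contDiff_id (𝕜 := ℝ) (n := ∞)) 0).continuous.continuousOn
      · exact (congrArg chartCoord (h' u)).trans (chartCoord_chart _))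

/-- A point of the circle, as a point of the space `F`. -/
noncomputable def circlePt (t : ℝ) : S.F :=
  ⟨chart (S.toFun t), _, Or.inr rfl, WithLp.toLp 2 fun _ => t, rfl⟩

theorem chartCoord_circlePt (t : ℝ) : chartCoord (S.FIncl.toFun (S.circlePt t)) = S.toFun t :=
  chartCoord_chart _

theorem isPlot_circlePt : Diffeology.IsPlot fun u : EuclideanSpace ℝ (Fin 1) => S.circlePt (u 0) :=
  DiffeologicalSpace.isPlot_generatedFrom_of_mem (Or.inr rfl)

/-! ### The cocycle of a simplex -/

/-- The coordinates of the points of a simplex of `SmSing F`. -/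
noncomputable def simplexCoord {m : SimplexCategory} (σ : (SmSing.obj S.F).obj (op m))
    (x : stdSimplex ℝ (Fin (m.len + 1))) : Fin 3 → ℝ :=
  chartCoord (S.FIncl.toFun ((SmReal.simplexHom σ).toFun (ExtSimplex.ofStdSimplex x)))

/-- The simplex is restricted to the standard simplex inside the extended one in order to have
compactness. -/
theorem exists_isPrimitive_simplexCoord {m : SimplexCategory} (σ : (SmSing.obj S.F).obj (op m)) :
    ∃ h, S.IsPrimitive (S.simplexCoord σ) h := by
  refine exists_isPrimitive (convex_stdSimplex ℝ _) (isCompact_stdSimplex ℝ _) fun x => ?_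
  let b : stdSimplex ℝ (Fin (m.len + 1)) → EuclideanSpace ℝ (Fin m.len) :=
    fun x => ExtSimplex.toAffine (ExtSimplex.ofStdSimplex x)
  have hb : Continuous b := ExtSimplex.continuous_toAffine_ofStdSimplex
  obtain ⟨N, hN, hm⟩ := S.exists_localModel_FIncl
    ((SmReal.simplexHom σ).smooth _ _ ExtSimplex.isPlot_ofAffine) (b x)
  have hN' : b ⁻¹' N ∈ 𝓝 x := hb.continuousAt.preimage_mem_nhds hN
  refine LocalModel.exists_localPrimitive ?_ hN'
  refine (hm.comp hb.continuousOn (Set.mapsTo_preimage b N)).congr fun y _ => ?_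
  change _ = chartCoord (S.FIncl.toFun ((SmReal.simplexHom σ).toFun (ExtSimplex.ofAffine (b y))))
  rw [ExtSimplex.ofAffine_toAffine]
  rfl

/-- A primitive of a simplex of `SmSing F`. -/
noncomputable def prim {m : SimplexCategory} (σ : (SmSing.obj S.F).obj (op m)) :
    stdSimplex ℝ (Fin (m.len + 1)) → ℝ :=
  (S.exists_isPrimitive_simplexCoord σ).choose

theorem isPrimitive_prim {m : SimplexCategory} (σ : (SmSing.obj S.F).obj (op m)) :
    S.IsPrimitive (S.simplexCoord σ) (S.prim σ) :=
  (S.exists_isPrimitive_simplexCoord σ).choose_spec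

variable {S} in
-- The function `prim` is an arbitrary choice, but its increments are canonical; this makes
-- `cocycleMap` simplicial.
theorem IsPrimitive.sub_eq_prim {m : SimplexCategory} {σ : (SmSing.obj S.F).obj (op m)}
    {h : stdSimplex ℝ (Fin (m.len + 1)) → ℝ} (hh : S.IsPrimitive (S.simplexCoord σ) h)
    (x y : stdSimplex ℝ (Fin (m.len + 1))) : h y - h x = S.prim σ y - S.prim σ x := by
  have := (convex_stdSimplex ℝ (Fin (m.len + 1))).locallyPathConnectedSpace
  have := hh.sub_eq (S.isPrimitive_prim σ) x y
  linarith

/-- The map from `SmSing F` to the complex of cocycles given by the increments of the primitives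
along the edges. -/
noncomputable def cocycleMap : SmSing.obj S.F ⟶ cocycleComplex where
  app m := TypeCat.ofHom fun σ =>
    ⟨fun i j => S.prim (m := m.unop) σ (stdSimplex.vertex j) -
      S.prim (m := m.unop) σ (stdSimplex.vertex i), fun _ _ _ => by ring⟩
  naturality := by
    rintro ⟨n⟩ ⟨m⟩ f
    ext σ
    refine cocycleComplex.ext_val fun i j => ?_
    -- The pullback of a primitive along a map of simplices is a primitive of the pulled back
    -- simplex, so it has the same increments as the chosen one.
    have h : S.IsPrimitive (S.simplexCoord ((SmSing.obj S.F).map f σ))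
        (S.prim σ ∘ stdSimplex.map f.unop.toOrderHom) := by
      have h1 := (S.isPrimitive_prim σ).comp
        (stdSimplex.continuous_map (S := ℝ) f.unop.toOrderHom)
      have h2 : S.simplexCoord ((SmSing.obj S.F).map f σ) =
          S.simplexCoord σ ∘ stdSimplex.map f.unop.toOrderHom := funext fun x =>
        congrArg (fun y => chartCoord (S.FIncl.toFun ((SmReal.simplexHom σ).toFun y)))
          (ExtSimplex.map_ofStdSimplex f.unop x)
      rwa [h2]
    have := h.sub_eq_prim (stdSimplex.vertex i) (stdSimplex.vertex j)
    simp only [Function.comp_apply, stdSimplex.map_vertex] at this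
    exact this.symm

/-! ### The class of the circle -/

theorem isPlot_circlePt_comp {n : ℕ} {g : EuclideanSpace ℝ (Fin n) → ℝ} (hg : ContDiff ℝ ∞ g) :
    Diffeology.IsPlot fun u => S.circlePt (g u) :=
  Diffeology.isPlot_reparam S.isPlot_circlePt
    (f := fun u => (WithLp.toLp 2 fun _ => g u : EuclideanSpace ℝ (Fin 1)))
    (contDiff_euclidean.2 fun _ => hg)

/-- A simplex of `SmSing F` that factors through the circle. -/
noncomputable def circleSimplex {m : SimplexCategory} (q : ExtSimplex m → ℝ)
    (hq : ∀ (n : ℕ) (p : EuclideanSpace ℝ (Fin n) → ExtSimplex m), Diffeology.IsPlot p →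
      ContDiff ℝ ∞ fun u => q (p u)) : (SmSing.obj S.F).obj (op m) :=
  Diffeo.Hom.mk (X := extSimplexFunctor.obj m) (Y := S.F)
    (fun x => S.circlePt (q x)) fun n p hp => S.isPlot_circlePt_comp (hq n p hp)

/-- The loop in `SmSing F` given by the circle. -/
noncomputable def loop : (SmSing.obj S.F).obj (op ⦋1⦌) :=
  -- The parameter runs over one period from -1 to 5, so that the standard simplex stays in the
  -- window (-2, 6) and both ends are outside [0, 1].
  S.circleSimplex (fun y => 6 * y.coord 1 - 1) fun _ _ hp =>
    (contDiff_const.mul (ExtSimplex.coord_contDiff hp 1)).sub contDiff_const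

theorem loop_δ : (SmSing.obj S.F).δ 0 S.loop = (SmSing.obj S.F).δ 1 S.loop :=
  Diffeo.hom_ext fun (y : ExtSimplex ⦋0⦌) => by
    have h : S.toFun (6 * (ExtSimplex.map (SimplexCategory.δ 0) y).coord 1 - 1) =
        S.toFun (6 * (ExtSimplex.map (SimplexCategory.δ 1) y).coord 1 - 1) := by
      rw [ExtSimplex.map_δ_zero_coord_one, ExtSimplex.map_δ_one_coord_one]
      convert S.periodic (-1) using 2 <;> norm_num
    exact Subtype.ext (congrArg chart h)

/-- The loop has a global lift `c` on the standard simplex, so `cantorFun ∘ c` is a primitive; it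
goes from 0 to 1. -/
theorem val_loop : cocycleComplex.val (S.cocycleMap.app (op ⦋1⦌) S.loop) 0 1 = 1 := by
  let c : stdSimplex ℝ (Fin 2) → ℝ := fun x => 6 * x 1 - 1
  have hc : Continuous c :=
    (continuous_const.mul ((continuous_apply 1).comp continuous_subtype_val)).sub continuous_const
  have h : S.IsPrimitive (S.simplexCoord S.loop) (cantorFun ∘ c) := fun x =>
    ⟨Set.univ, univ_mem, Or.inr ⟨c, hc.continuousOn, fun y _ => ⟨⟨?_, ?_⟩,
      S.chartCoord_circlePt _⟩, 0, fun y _ => (add_zero _).symm⟩⟩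
  · have := h.sub_eq_prim (stdSimplex.vertex 0) (stdSimplex.vertex 1)
    refine this.symm.trans ?_
    have h1 : c (stdSimplex.vertex 1) = 5 := by
      simp [c]
      norm_num
    have h0 : c (stdSimplex.vertex 0) = -1 := by
      simp [c]
    rw [Function.comp_apply, Function.comp_apply, h0, h1, cantorFun_of_one_le (by norm_num),
      cantorFun_of_nonpos (by norm_num), sub_zero]
  · have := stdSimplex.zero_le y 1
    simp only [c]
    linarith
  · have := stdSimplex.le_one y 1
    simp only [c]
    linarith

/-- The inclusion of `F` in `|Δ³|` is not a weak equivalence. -/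
theorem not_weakEquivalence : ¬ WeakEquivalence (SmSing.map S.FIncl) := by
  intro hw
  have hw' : IsWeakEquiv (SmSing.map S.FIncl) := hw.mem
  -- A weak equivalence would let the class of `cocycleMap` extend to SmSing |Δ³|, where the image
  -- of the loop has value 0.
  obtain ⟨h, ⟨H⟩⟩ := (hw' cocycleComplex).1 S.cocycleMap
  have h1 := cocycleComplex.val_eq_of_homotopy H S.loop_δ
  rw [S.val_loop] at h1
  have h2 := cocycleComplex.val_loop_eq_zero h
    (γ := (SmSing.map S.FIncl).app (op ⦋1⦌) S.loop) (by
      have e := fun i : Fin 2 =>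
        ConcreteCategory.congr_hom ((SmSing.map S.FIncl).naturality (SimplexCategory.δ i).op) S.loop
      exact (e 0).symm.trans ((congrArg ((SmSing.map S.FIncl).app (op ⦋0⦌)) S.loop_δ).trans (e 1)))
  exact zero_ne_one (h2.symm.trans h1)

end OscillatingCircle

/-! ### The pushout square and the transferred model structure -/

namespace OscillatingCircle

variable (S : OscillatingCircle)

theorem hornToF_surjective : Function.Surjective S.hornToF.toFun := fun y => by
  obtain ⟨i, hi⟩ := S.exists_chartCoord_FIncl y
  obtain ⟨x, hx⟩ := exists_smoothHorn_eq hi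
  exact ⟨x, Subtype.ext hx⟩

/-- In a cocone the map on |Δ³| determines the map on F, because `hornToF` is surjective; so a
cocone is nothing but a map out of |Δ³|. -/
theorem isPushout : IsPushout S.hornToF smoothHorn S.FIncl (𝟙 (smReal.obj Δ[3])) where
  w := rfl
  isColimit' := ⟨Limits.PushoutCocone.isColimitAux' _ fun s => by
    refine ⟨s.inr, Diffeo.hom_ext fun y => ?_, Category.id_comp _, fun {m} _ hm => ?_⟩
    · obtain ⟨x, rfl⟩ := S.hornToF_surjective y
      exact (congrFun (congrArg Diffeo.Hom.toFun s.condition) x).symm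
    · exact (Category.id_comp m).symm.trans hm⟩

end OscillatingCircle

/-- In a model structure transferred along `SmSing`, the smooth horn inclusions are trivial
cofibrations. -/
theorem trivialCofibrations_smoothHorn [ModelCategory Diffeo] (h : IsTransferredAlong SmSing) :
    trivialCofibrations Diffeo smoothHorn := by
  rw [← fibrations_llp]
  intro X Y p hp
  -- The lifting problem becomes that of the simplicial horn inclusion against a Kan fibration.
  refine (smAdj.hasLiftingProperty_iff (Λ[3, 0] : (Δ[3] : SSet.{0}).Subcomplex).ι p).2 ?_
  rw [h.2] at hp
  have : Fibration (SmSing.map p) := ⟨hp⟩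
  infer_instance

theorem not_isTransferredAlong_smSing :
    ¬ ∃ _ : ModelCategory Diffeo, IsTransferredAlong SmSing := by
  rintro ⟨_, h⟩
  obtain ⟨S⟩ := nonempty_oscillatingCircle
  have hF : trivialCofibrations Diffeo S.FIncl :=
    MorphismProperty.of_isPushout S.isPushout (trivialCofibrations_smoothHorn h)
  have hw := trivialCofibrations_sub_weakEquivalences _ _ hF
  rw [h.1] at hw
  exact S.not_weakEquivalence ⟨hw⟩

theorem theorem6p3 :
    (¬ ∃ _ : ModelCategory Diffeo, IsTransferredAlong SmSing) ∧
    Nonempty OscillatingCircle ∧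
    ∀ S : OscillatingCircle,
      IsPushout S.hornToF smoothHorn S.FIncl (𝟙 (smReal.obj Δ[3])) ∧
      ¬ WeakEquivalence (SmSing.map S.FIncl) :=
  ⟨not_isTransferredAlong_smSing, nonempty_oscillatingCircle,
    fun S => ⟨S.isPushout, S.not_weakEquivalence⟩⟩
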